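/- Let $d\ge 2$ be an integer and let $\Omega\subset\mathbb R^d$ be a bounded Lebesgue measurable set of finite perimeter $$\mathrm{Per}(\Omega)=\sup\Big\{\int_\Omega \operatorname{div}\varphi\,dx:\ \varphi\in C^1_c(\mathbb R^d,\mathbb R^d),\ \|\varphi\|_\infty\le 1\Big\}<\infty .$$ Let $\beta\in\mathbb R$, $\gamma>0$, and for $t>0$ let $p_t:\mathbb R^d\to[0,\infty]$ be radial and integrable functions with $p_t(x)=t^{\beta}p_1(t^{-\gamma}x)$ for all $t>0$, $x\in\mathbb R^d$. Put $$H_\Omega(t)=\int_\Omega\int_\Omega p_t(x-y)\,dy\,dx,\qquad D(t)=\|p_1\|_{1}\,|\Omega|-t^{-(\beta+d\gamma)}H_\Omega(t)\qquad(t>0),$$ $w_k=\pi^{k/2}/\Gamma(1+k/2)$, $A_d=d\,w_d$, $e_d=(0,\dots,0,1)\in\mathbb R^d$, and let $\ell_\Omega$ be the diameter of $\Omega$. (i) If $|\cdot|\,p_1\in L^1(\mathbb R^d)$, then for all $t>0$ $$D(t)\le t^{\gamma}\,w_{d-1}\,\mathrm{Per}(\Omega)\int_0^\infty r^d\,p_1(r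 e_d)\,dr,$$ and $$\lim_{t\to0+}\frac{D(t)}{t^\gamma}=w_{d-1}\,\mathrm{Per}(\Omega)\int_0^\infty r^d\,p_1(r e_d)\,dr .$$ (ii) If $p_t(x)=\dfrac{\kappa\,t^\beta}{(1+|t^{-\gamma}x|^n)^m}$ for all $t>0$ and $x\in\mathbb R^d$, with real numbers $\kappa,n,m>0$ such that $d-nm=-1$, then for all $t>0$ with $t^\gamma<\ell_\Omega$ $$D(t)\le t^\gamma\Big(\lambda(\Omega)+\kappa\,w_{d-1}\,\mathrm{Per}(\Omega)\,\gamma\ln\tfrac1t\Big),$$ where $$\lambda(\Omega)=|\Omega|\,\ell_\Omega^{-1}A_d\,\kappa+\kappa\,w_{d-1}\,\mathrm{Per}(\Omega)\Big(\ln\ell_\Omega+\int_0^1\frac{r^d\,dr}{(1+r^n)^m}\Big),$$ and $$\limsup_{t\to0+}\frac{D(t)}{t^\gamma\ln(1/t)}\le\kappa\,\mathrm{Per}(\Omega)\,w_{d-1}\,\gamma .$$ (iii) Suppose that there are functions $\phi:[0,1]\to[0,\infty)$ with $\phi(t)>0$ for $0<t\le1$, and $J,\Lambda:\mathbb R^d\to(0,\infty]$,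 such that $p_t(x)/\phi(t)\le\Lambda(x)$ for all $x\ne0$ and $0<t\le1$, $\lim_{t\to0+}p_t(x)/\phi(t)=J(x)$ for all $x\neq0$, and $$\int_\Omega\int_{\Omega^c}J(x-y)\,dy\,dx<\infty,\qquad \int_\Omega\int_{\Omega^c}\Lambda(x-y)\,dy\,dx<\infty .$$ Then $$\lim_{t\to0+}\frac{t^{d\gamma+\beta}\,\|p_1\|_1\,|\Omega|-H_\Omega(t)}{\phi(t)}=\int_\Omega\int_{\Omega^c}J(x-y)\,dy\,dx .$$ -/

import Mathlib

open MeasureTheory Set Filter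
open scoped Topology ENNReal NNReal

noncomputable section

namespace HeatContent

/-- Euclidean space `ℝ^d`, with the Euclidean norm and Lebesgue measure `volume`. -/
abbrev E (d : ℕ) : Type := EuclideanSpace ℝ (Fin d)

/-- The vector `e_d = (0, …, 0, 1)`. -/
def lastVec (d : ℕ) : E d :=
  WithLp.toLp 2 (fun i : Fin d => if (i : ℕ) + 1 = d then (1 : ℝ) else 0)

/-- The volume `w_k = π^{k/2} / Γ(1 + k/2)` of the unit ball of `ℝ^k`. -/
def ballVol (k : ℕ) : ℝ :=
  Real.pi ^ ((k : ℝ) / 2) / Real.Gamma (1 + (k : ℝ) / 2)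

/-- The surface area `A_k = k w_k` of the unit ball of `ℝ^k`. -/
def sphereArea (k : ℕ) : ℝ := (k : ℝ) * ballVol k

/-- The divergence `∑ i, ∂ᵢ φᵢ` of a vector field. -/
def divergence {d : ℕ} (φ : E d → E d) (x : E d) : ℝ :=
  ∑ i : Fin d, (fderiv ℝ φ x (EuclideanSpace.single i (1 : ℝ))) i

/-- The perimeter: the supremum of `∫_Ω div φ` over the `C¹` compactly supported vector fields
with `|φ| ≤ 1` everywhere.  The field `φ = 0` is admissible, so that the supremum is nonnegative
and cutting off negative values does not change it. -/
def perimeter {d : ℕ} (Ω : Set (E d)) : ℝ≥0∞ :=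
  ⨆ (φ : E d → E d) (_ : ContDiff ℝ 1 φ) (_ : HasCompactSupport φ) (_ : ∀ x, ‖φ x‖ ≤ 1),
    ENNReal.ofReal (∫ x in Ω, divergence φ x)

/-- A heat kernel with scaling exponents `β` and `γ > 0`: for `t > 0`, the function
`p t : ℝ^d → [0, ∞]` is radial and integrable, and `p_t(x) = t^β p_1(t^{-γ} x)`. -/
structure IsHeatKernel {d : ℕ} (β γ : ℝ) (p : ℝ → E d → ℝ≥0∞) : Prop where
  gamma_pos : 0 < γ
  radial : ∀ t : ℝ, 0 < t → ∀ x y : E d, ‖x‖ = ‖y‖ → p t x = p t y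
  aemeasurable : ∀ t : ℝ, 0 < t → AEMeasurable (p t) volume
  lintegral_lt_top : ∀ t : ℝ, 0 < t → ∫⁻ x, p t x < ∞
  scaling : ∀ t : ℝ, 0 < t → ∀ x : E d,
    p t x = ENNReal.ofReal (t ^ β) * p 1 (t ^ (-γ) • x)

/-- The heat content `H_Ω(t) = ∫_Ω ∫_Ω p_t(x - y) dy dx`. -/
def heatContent {d : ℕ} (p : ℝ → E d → ℝ≥0∞) (Ω : Set (E d)) (t : ℝ) : ℝ≥0∞ :=
  ∫⁻ x in Ω, ∫⁻ y in Ω, p t (x - y)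

/-- The `L¹` norm of the kernel at time one, as a real number. -/
def kernelNorm {d : ℕ} (p : ℝ → E d → ℝ≥0∞) : ℝ := (∫⁻ x, p 1 x).toReal

/-- The heat deficit `‖p_1‖₁ |Ω| - t^{-(β + dγ)} H_Ω(t)`. -/
def deficit {d : ℕ} (β γ : ℝ) (p : ℝ → E d → ℝ≥0∞) (Ω : Set (E d)) (t : ℝ) : ℝ :=
  kernelNorm p * (volume Ω).toReal
    - t ^ (-(β + (d : ℝ) * γ)) * (heatContent p Ω t).toReal

/-- The radial moment `∫_0^∞ r^d p_1(r e_d) dr`. -/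
def radialMoment {d : ℕ} (p : ℝ → E d → ℝ≥0∞) : ℝ≥0∞ :=
  ∫⁻ r in Ioi (0 : ℝ), ENNReal.ofReal (r ^ d) * p 1 (r • lastVec d)

/-- The constant
`λ(Ω) = |Ω| ℓ⁻¹ A_d κ + κ w_{d-1} Per(Ω) (ln ℓ + ∫_0^1 r^d / (1 + r^n)^m dr)`,
where `ℓ` is the diameter of `Ω`. -/
def lambdaConst {d : ℕ} (κ n m : ℝ) (Ω : Set (E d)) : ℝ :=
  (volume Ω).toReal * (Metric.diam Ω)⁻¹ * sphereArea d * κ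
    + κ * ballVol (d - 1) * (perimeter Ω).toReal
      * (Real.log (Metric.diam Ω) + ∫ r in (0 : ℝ)..1, r ^ d / (1 + r ^ n) ^ m)

end HeatContent

end

noncomputable section

namespace HeatContent

/-! By Fubini the heat lost is the heat exchanged between `Ω` and its complement. Substituting `z =
x - y` and rescaling gives `D(t) = ½ ∫ p_1(z) V(t^γ z) dz`, where `V(z) = ‖χ_Ω(· + z) - χ_Ω‖₁`
(`exchange_eq`, `deficit_eq`). So (i) and (ii) concern `V` near the origin.

For smooth `f` the shift modulus is at most `∫ |Df(x) z| dx`, sharply to first order. Averaging over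
a radial `q` turns `|⟪∇f(x), z⟫|` into a constant times `|∇f(x)|`, the constant being `2 w_{d-1} ∫
r^d q(r e_d) dr` (`lintegral_radial_mul_inner`). Apply this to mollifications `f_k` of `χ_Ω`.
Duality bounds `∫ |∇f_k|` by the perimeter, and the supremum over `k` reaches it
(`lintegral_gradient_mollify_le`, `perimeter_le_iSup_gradient`). Fatou in `k` yields the upper bound
at every scale (`lintegral_mul_shiftVariation_le`). Mollification does not increase the shift
modulus, so Fatou in the scale yields the matching lower bound
(`dirMoment_mul_perimeter_le_liminf`). No structure theory of BV functions and no pointwise limit of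
`V(sz)/s` is needed, because the average over `z` is taken before the limits.

In (ii) the first moment may diverge logarithmically. The kernel is cut at rescaled radius `ℓ /
t^γ`: the inner part obeys the bound of (i) with a logarithmic moment, and the outer part uses `V ≤
2|Ω|` and the tail mass. Part (iii) is dominated convergence on `Ω × Ωᶜ`, which misses the diagonal.
-/

/-! ### Polar coordinates and moments of radial functions. -/

open Measure in
lemma lintegral_eq_lintegral_sphere_prod {d : ℕ} (F : E d → ℝ≥0∞) :
    ∫⁻ x in ({0}ᶜ : Set (E d)), F x =
      ∫⁻ y, F ((y.2 : ℝ) • (y.1 : E d))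
        ∂((volume : Measure (E d)).toSphere.prod (volumeIoiPow (d - 1))) := by
  have h := (measurePreserving_homeomorphUnitSphereProd (volume : Measure (E d))).lintegral_comp_emb
    (Homeomorph.measurableEmbedding _)
    (fun y => F ((y.2 : ℝ) • (y.1 : E d)))
  rw [finrank_euclideanSpace, Fintype.card_fin] at h
  rw [← h, ← lintegral_subtype_comap (measurableSet_singleton _).compl]
  refine lintegral_congr fun x => ?_
  have hx : ‖(x : E d)‖ ≠ 0 := norm_ne_zero_iff.2 x.2
  simp [smul_smul, hx]

open Measure in
lemma lintegral_volumeIoiPow (n : ℕ) (G : ℝ → ℝ≥0∞) :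
    ∫⁻ r, G r ∂(volumeIoiPow n) = ∫⁻ r in Ioi (0 : ℝ), ENNReal.ofReal (r ^ n) * G r := by
  rw [volumeIoiPow, lintegral_withDensity_eq_lintegral_mul_non_measurable]
  · exact lintegral_subtype_comap measurableSet_Ioi (fun r : ℝ => ENNReal.ofReal (r ^ n) * G r)
  · fun_prop
  · exact ae_of_all _ fun _ => ENNReal.ofReal_lt_top

lemma norm_lastVec {d : ℕ} (hd : 1 ≤ d) : ‖lastVec d‖ = 1 := by
  obtain ⟨k, rfl⟩ : ∃ k, d = k + 1 := ⟨d - 1, by omega⟩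
  have : lastVec (k + 1) = EuclideanSpace.single (Fin.last k) (1 : ℝ) := by
    ext i
    simp [lastVec, Fin.ext_iff]
  rw [this]
  simp

section Radial

variable {d : ℕ} {q : E d → ℝ≥0∞}

open Measure in
-- A single ray may be a null set, so restricting `q` to it proves nothing. Instead, in polar
-- coordinates `q` depends on the radius alone; almost every section over the sphere is a.e.
-- measurable, and any one of them is the profile.
lemma aemeasurable_radial_profile (hd : 1 ≤ d) (hq : AEMeasurable q volume)
    (hr : ∀ x y : E d, ‖x‖ = ‖y‖ → q x = q y) :
    AEMeasurable (fun r : Ioi (0 : ℝ) => q ((r : ℝ) • lastVec d)) (volumeIoiPow (d - 1)) := by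
  have hnt : Nontrivial (E d) :=
    ⟨⟨lastVec d, 0, fun h => by have := norm_lastVec hd; simp [h] at this⟩⟩
  have h := measurePreserving_homeomorphUnitSphereProd (volume : Measure (E d))
  rw [finrank_euclideanSpace, Fintype.card_fin] at h
  have h1 : AEMeasurable (fun x : ({0}ᶜ : Set (E d)) => q x) ((volume : Measure (E d)).comap (↑)) :=
    (MeasurableEmbedding.subtype_coe (measurableSet_singleton (0 : E d)).compl).aemeasurable_map_iff.1
      (by rw [map_comap_subtype_coe (measurableSet_singleton (0 : E d)).compl]
          exact hq.restrict)
  have h2 : AEMeasurable (fun y : Metric.sphere (0 : E d) 1 × Ioi (0 : ℝ) =>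
      q ((y.2 : ℝ) • lastVec d)) ((volume : Measure (E d)).toSphere.prod (volumeIoiPow (d - 1))) := by
    rw [← h.map_eq, (Homeomorph.measurableEmbedding _).aemeasurable_map_iff]
    refine h1.congr (ae_of_all _ fun x => hr _ _ ?_)
    simp [norm_smul, norm_lastVec hd]
  have h3 := h2.aestronglyMeasurable.prodMk_left
  have : NeBot (ae (volume : Measure (E d)).toSphere) := ae_neBot.2 (toSphere_ne_zero _)
  obtain ⟨u, hu⟩ := h3.exists
  exact hu.aemeasurable

open Measure in
-- Homogeneity of the weight makes the integrand a product in polar coordinates. Degree 0 is used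
-- for masses, degree 1 for first moments.
lemma lintegral_radial_mul (hd : 1 ≤ d) (hq : AEMeasurable q volume)
    (hr : ∀ x y : E d, ‖x‖ = ‖y‖ → q x = q y) {w : E d → ℝ≥0∞} (hw : Measurable w) (k : ℕ)
    (hk : ∀ r : ℝ, 0 < r → ∀ u, w (r • u) = ENNReal.ofReal (r ^ k) * w u) :
    ∫⁻ x, q x * w x = (∫⁻ u, w u ∂(volume : Measure (E d)).toSphere) *
      ∫⁻ r in Ioi (0 : ℝ), ENNReal.ofReal (r ^ (d - 1 + k)) * q (r • lastVec d) := by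
  have hnt : Nontrivial (E d) :=
    ⟨⟨lastVec d, 0, fun h => by have := norm_lastVec hd; simp [h] at this⟩⟩
  have h0 : ∫⁻ x, q x * w x = ∫⁻ x in ({0}ᶜ : Set (E d)), q x * w x := by
    rw [restrict_compl_singleton]
  rw [h0, lintegral_eq_lintegral_sphere_prod]
  have h1 : ∀ y : Metric.sphere (0 : E d) 1 × Ioi (0 : ℝ),
      q ((y.2 : ℝ) • (y.1 : E d)) * w ((y.2 : ℝ) • (y.1 : E d))
        = w y.1 * (ENNReal.ofReal ((y.2 : ℝ) ^ k) * q ((y.2 : ℝ) • lastVec d)) := fun y => by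
    rw [hk _ y.2.2, hr ((y.2 : ℝ) • (y.1 : E d)) ((y.2 : ℝ) • lastVec d)
      (by simp [norm_smul, norm_lastVec hd])]
    ring
  simp_rw [h1]
  rw [lintegral_prod_mul (f := fun u : Metric.sphere (0 : E d) 1 => w u)
    (g := fun r : Ioi (0 : ℝ) => ENNReal.ofReal ((r : ℝ) ^ k) * q ((r : ℝ) • lastVec d))
    (by fun_prop) (AEMeasurable.mul (by fun_prop) (aemeasurable_radial_profile hd hq hr)),
    lintegral_volumeIoiPow _ (fun r => ENNReal.ofReal (r ^ k) * q (r • lastVec d))]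
  congr 1
  refine setLIntegral_congr_fun measurableSet_Ioi fun r hr => ?_
  have hr0 : (0 : ℝ) < r := hr
  rw [pow_add, ENNReal.ofReal_mul (by positivity), mul_assoc]

end Radial

lemma integral_abs_mul_exp_neg_sq : ∫ x : ℝ, |x| * Real.exp (-x ^ 2) = 1 := by
  have h := integral_comp_abs (f := fun x : ℝ => x * Real.exp (-x ^ 2))
  simp only [sq_abs] at h
  rw [h]
  have := integral_rpow_mul_exp_neg_rpow (p := 2) (q := 1) (by norm_num) (by norm_num)
  norm_num at this
  rw [this]
  norm_num

lemma integrable_abs_mul_exp_neg_sq : Integrable fun x : ℝ => |x| * Real.exp (-x ^ 2) := by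
  have h := (integrable_mul_exp_neg_mul_sq (b := 1) one_pos).norm
  refine h.congr (ae_of_all _ fun x => ?_)
  simp

/-- The integrand factors over coordinates: the `i`-th factor integrates to 1, each of the others to
`√π`. -/
lemma lintegral_gaussian_mul_abs_coord (d : ℕ) (i : Fin d) :
    ∫⁻ x : E d, ENNReal.ofReal (Real.exp (-‖x‖ ^ 2)) * ‖x i‖ₑ
      = ENNReal.ofReal (Real.pi ^ (((d - 1 : ℕ) : ℝ) / 2)) := by
  set f : Fin d → ℝ → ℝ := fun j x => if j = i then |x| * Real.exp (-x ^ 2) else Real.exp (-x ^ 2)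
    with hf
  have hint : ∀ j, Integrable (f j) := fun j => by
    by_cases h : j = i
    · simpa [hf, h] using integrable_abs_mul_exp_neg_sq
    · simpa [hf, h] using integrable_exp_neg_mul_sq (b := 1) one_pos
  have key : ∀ y : Fin d → ℝ, ENNReal.ofReal (Real.exp (-‖WithLp.toLp 2 y‖ ^ 2)) * ‖y i‖ₑ
      = ENNReal.ofReal (∏ j, f j (y j)) := fun y => by
    rw [Real.enorm_eq_ofReal_abs, ← ENNReal.ofReal_mul (Real.exp_pos _).le,
      EuclideanSpace.norm_sq_eq, ← Finset.sum_neg_distrib, Real.exp_sum,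
      ← Finset.mul_prod_erase _ _ (Finset.mem_univ i), ← Finset.mul_prod_erase _ (fun j => f j (y j))
        (Finset.mem_univ i)]
    have : ∏ x ∈ Finset.univ.erase i, f x (y x)
        = ∏ x ∈ Finset.univ.erase i, Real.exp (-‖y x‖ ^ 2) :=
      Finset.prod_congr rfl fun j hj => by simp [hf, Finset.ne_of_mem_erase hj]
    rw [this]
    simp [hf]
    ring_nf
  rw [← (EuclideanSpace.volume_preserving_symm_measurableEquiv_toLp (Fin d)).symm.lintegral_comp_emb
    (MeasurableEquiv.measurableEmbedding _)]
  have : ∀ y : Fin d → ℝ, ENNReal.ofReal (Real.exp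
      (-‖(MeasurableEquiv.toLp 2 (Fin d → ℝ)).symm.symm y‖ ^ 2)) *
        ‖((MeasurableEquiv.toLp 2 (Fin d → ℝ)).symm.symm y) i‖ₑ
      = ENNReal.ofReal (∏ j, f j (y j)) := key
  simp_rw [this]
  have hprod : Integrable (fun y : Fin d → ℝ => ∏ j, f j (y j)) := Integrable.fintype_prod hint
  rw [← ofReal_integral_eq_lintegral_ofReal hprod
    (ae_of_all _ fun y => Finset.prod_nonneg fun j _ => by
      simp only [hf]; split_ifs <;> positivity), integral_fintype_prod_volume_eq_prod]
  congr 1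
  rw [← Finset.mul_prod_erase _ _ (Finset.mem_univ i)]
  have h1 : ∫ x, f i x = 1 := by simpa [hf] using integral_abs_mul_exp_neg_sq
  have h2 : ∀ j ∈ Finset.univ.erase i, ∫ x, f j x = √Real.pi := fun j hj => by
    simpa [hf, Finset.ne_of_mem_erase hj] using integral_gaussian 1
  rw [h1, Finset.prod_congr rfl h2, Finset.prod_const, Finset.card_erase_of_mem (Finset.mem_univ i),
    Finset.card_univ, Fintype.card_fin, one_mul, Real.sqrt_eq_rpow, ← Real.rpow_mul_natCast
    Real.pi_pos.le]
  congr 1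
  ring

lemma lintegral_pow_mul_exp_neg_sq (d : ℕ) :
    ∫⁻ r in Ioi (0 : ℝ), ENNReal.ofReal (r ^ d) * ENNReal.ofReal (Real.exp (-r ^ 2))
      = ENNReal.ofReal (Real.Gamma (((d : ℝ) + 1) / 2) / 2) := by
  have h := integral_rpow_mul_exp_neg_rpow (p := 2) (q := d) (by norm_num)
    (by linarith [(Nat.cast_nonneg d : (0 : ℝ) ≤ d)])
  have hi := integrableOn_rpow_mul_exp_neg_rpow (s := (d : ℝ)) (p := 2)
    (by linarith [(Nat.cast_nonneg d : (0 : ℝ) ≤ d)]) (by norm_num)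
  norm_num at h hi
  rw [show Real.Gamma (((d : ℝ) + 1) / 2) / 2 = 1 / 2 * Real.Gamma (((d : ℝ) + 1) / 2) by ring, ← h,
    ofReal_integral_eq_lintegral_ofReal hi]
  · refine setLIntegral_congr_fun measurableSet_Ioi fun r hr => ?_
    have hr0 : (0 : ℝ) < r := hr
    exact (ENNReal.ofReal_mul (by positivity)).symm
  · refine (ae_restrict_mem measurableSet_Ioi).mono fun r hr => ?_
    have hr0 : (0 : ℝ) < r := hr
    simp only [Pi.zero_apply]
    positivity

lemma ballVol_pos (k : ℕ) : 0 < ballVol k := by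
  unfold ballVol
  have := Real.Gamma_pos_of_pos (s := 1 + (k : ℝ) / 2) (by positivity)
  positivity

/-- The same Gaussian moment is computed in Cartesian and in polar coordinates; dividing by the
radial factor leaves the spherical integral. -/
lemma lintegral_sphere_abs_coord {d : ℕ} (hd : 1 ≤ d) (i : Fin d) :
    ∫⁻ u, ‖(u : E d) i‖ₑ ∂(volume : Measure (E d)).toSphere
      = ENNReal.ofReal (2 * ballVol (d - 1)) := by
  have h := lintegral_radial_mul (q := fun x : E d => ENNReal.ofReal (Real.exp (-‖x‖ ^ 2))) hd
    (by fun_prop) (fun x y h => by simp only [h]) (w := fun x => ‖x i‖ₑ) (by fun_prop) 1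
    (fun r hr u => by
      rw [PiLp.smul_apply, smul_eq_mul, enorm_mul, pow_one, Real.enorm_of_nonneg hr.le])
  rw [lintegral_gaussian_mul_abs_coord, Nat.sub_add_cancel hd] at h
  have h1 : ∫⁻ r in Ioi (0 : ℝ), ENNReal.ofReal (r ^ d) *
      ENNReal.ofReal (Real.exp (-‖r • lastVec d‖ ^ 2))
        = ENNReal.ofReal (Real.Gamma (((d : ℝ) + 1) / 2) / 2) := by
    rw [← lintegral_pow_mul_exp_neg_sq]
    simp [norm_smul, norm_lastVec hd]
  rw [h1] at h
  have hG : 0 < Real.Gamma (((d : ℝ) + 1) / 2) := Real.Gamma_pos_of_pos (by positivity)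
  rw [← ENNReal.mul_left_inj (c := ENNReal.ofReal (Real.Gamma (((d : ℝ) + 1) / 2) / 2))
    (ENNReal.ofReal_pos.2 (by positivity)).ne' ENNReal.ofReal_ne_top, ← h,
    ← ENNReal.ofReal_mul (by have := ballVol_pos (d - 1); positivity), ballVol, Nat.cast_sub hd,
    show 1 + ((d : ℝ) - (1 : ℕ)) / 2 = ((d : ℝ) + 1) / 2 by push_cast; ring]
  congr 1
  field_simp

lemma exists_rotation {d : ℕ} (i : Fin d) (v : E d) :
    ∃ R : E d ≃ₗᵢ[ℝ] E d, R v = ‖v‖ • EuclideanSpace.single i (1 : ℝ) :=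
  -- The reflection exchanging two vectors of equal norm serves as the isometry.
  ⟨_, Submodule.reflection_sub (by simp [norm_smul])⟩

open Measure in
/-- The moment of a radial function against `|⟪v, ·⟫|`. -/
lemma lintegral_radial_mul_inner {d : ℕ} (hd : 1 ≤ d) {q : E d → ℝ≥0∞} (hq : AEMeasurable q volume)
    (hr : ∀ x y : E d, ‖x‖ = ‖y‖ → q x = q y) (v : E d) :
    ∫⁻ x, q x * ‖inner ℝ v x‖ₑ = ‖v‖ₑ * (ENNReal.ofReal (2 * ballVol (d - 1)) *
      ∫⁻ r in Ioi (0 : ℝ), ENNReal.ofReal (r ^ d) * q (r • lastVec d)) := by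
  have i : Fin d := ⟨0, hd⟩
  obtain ⟨R, hR⟩ := exists_rotation i v
  have h1 : ∫⁻ x, q x * ‖inner ℝ v x‖ₑ = ‖v‖ₑ * ∫⁻ x, q x * ‖x i‖ₑ := by
    rw [← lintegral_const_mul' _ _ enorm_ne_top,
      ← (R.measurePreserving).lintegral_comp_emb R.toHomeomorph.measurableEmbedding
      (fun x => ‖v‖ₑ * (q x * ‖x i‖ₑ))]
    refine lintegral_congr fun x => ?_
    have h2 : (inner ℝ v x : ℝ) = ‖v‖ * R x i := by
      rw [← R.inner_map_map, hR, inner_smul_left, EuclideanSpace.inner_single_left]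
      simp
    rw [h2, enorm_mul, enorm_norm, hr (R x) x (R.norm_map x)]
    ring
  have h := lintegral_radial_mul hd hq hr (w := fun x => ‖x i‖ₑ) (by fun_prop) 1
    (fun r hr u => by
      rw [PiLp.smul_apply, smul_eq_mul, enorm_mul, pow_one, Real.enorm_of_nonneg hr.le])
  rw [Nat.sub_add_cancel hd, lintegral_sphere_abs_coord hd] at h
  rw [h1, h]

lemma volume_unit_ball {d : ℕ} (hd : 1 ≤ d) :
    volume (Metric.ball (0 : E d) 1) = ENNReal.ofReal (ballVol d) := by
  have : Nonempty (Fin d) := ⟨⟨0, hd⟩⟩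
  rw [EuclideanSpace.volume_ball, Fintype.card_fin, ballVol, Real.sqrt_eq_rpow,
    ← Real.rpow_mul_natCast Real.pi_pos.le, add_comm (1 : ℝ)]
  simp only [ENNReal.ofReal_one, one_pow, one_mul]
  congr 3
  ring

open Measure in
lemma lintegral_radial {d : ℕ} (hd : 1 ≤ d) {q : E d → ℝ≥0∞} (hq : AEMeasurable q volume)
    (hr : ∀ x y : E d, ‖x‖ = ‖y‖ → q x = q y) :
    ∫⁻ x, q x = ENNReal.ofReal (sphereArea d) *
      ∫⁻ r in Ioi (0 : ℝ), ENNReal.ofReal (r ^ (d - 1)) * q (r • lastVec d) := by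
  have h := lintegral_radial_mul hd hq hr (w := fun _ => 1) measurable_const 0 (by simp)
  simpa [volume_unit_ball hd, sphereArea, ENNReal.ofReal_mul] using h

/-! ### Shift modulus against directional variation for smooth functions. -/

section Variation

variable {d : ℕ}

/-- The `L¹` modulus `∫ |f(x + h) - f(x)| dx`. -/
def shiftVariation (f : E d → ℝ) (h : E d) : ℝ≥0∞ := ∫⁻ x, ‖f (x + h) - f x‖ₑ

/-- The total variation of a smooth function in direction `h`. -/
def dirVariation (f : E d → ℝ) (h : E d) : ℝ≥0∞ := ∫⁻ x, ‖fderiv ℝ f x h‖ₑ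

lemma measurable_shiftVariation {f : E d → ℝ} (hf : Measurable f) :
    Measurable (shiftVariation f) :=
  Measurable.lintegral_prod_right' (f := fun z : E d × E d => ‖f (z.2 + z.1) - f z.2‖ₑ)
    (by fun_prop)

lemma continuous_fderiv_uncurry {f : E d → ℝ} (hf : ContDiff ℝ 1 f) :
    Continuous fun z : E d × E d => fderiv ℝ f z.1 z.2 :=
  ((hf.continuous_fderiv one_ne_zero).comp continuous_fst).clm_apply continuous_snd

lemma measurable_dirVariation {f : E d → ℝ} (hf : ContDiff ℝ 1 f) :
    Measurable (dirVariation f) :=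
  Measurable.lintegral_prod_right' (f := fun z : E d × E d => ‖fderiv ℝ f z.2 z.1‖ₑ)
    ((continuous_fderiv_uncurry hf).comp continuous_swap).measurable.enorm

lemma dirVariation_smul (f : E d → ℝ) (s : ℝ) (h : E d) :
    dirVariation f (s • h) = ‖s‖ₑ * dirVariation f h := by
  simp only [dirVariation, map_smul, smul_eq_mul, enorm_mul]
  exact lintegral_const_mul' _ _ enorm_ne_top

lemma enorm_sub_le_lintegral_fderiv {f : E d → ℝ} (hf : ContDiff ℝ 1 f) (x h : E d) :
    ‖f (x + h) - f x‖ₑ ≤ ∫⁻ s in Ioc (0 : ℝ) 1, ‖fderiv ℝ f (x + s • h) h‖ₑ := by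
  have hd : ∀ s : ℝ, HasDerivAt (fun s : ℝ => f (x + s • h)) (fderiv ℝ f (x + s • h) h) s :=
    fun s => by
      have h1 : HasDerivAt (fun s : ℝ => x + s • h) h s := by
        simpa using ((hasDerivAt_id s).smul_const h).const_add x
      exact ((hf.differentiable one_ne_zero) _).hasFDerivAt.comp_hasDerivAt s h1
  have hc : Continuous fun s : ℝ => fderiv ℝ f (x + s • h) h :=
    (continuous_fderiv_uncurry hf).comp (f := fun s : ℝ => (x + s • h, h)) (by fun_prop)
  have h2 := intervalIntegral.integral_eq_sub_of_hasDerivAt (a := 0) (b := 1) (fun s _ => hd s)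
    (hc.intervalIntegrable 0 1)
  simp only [one_smul, zero_smul, add_zero] at h2
  rw [← h2, intervalIntegral.integral_of_le zero_le_one]
  exact enorm_integral_le_lintegral_enorm _

/-- Integrate the derivative along the segment from `x` to `x + h`; after Tonelli, translation
invariance makes every slice contribute equally. -/
lemma shiftVariation_le_dirVariation {f : E d → ℝ} (hf : ContDiff ℝ 1 f) (h : E d) :
    shiftVariation f h ≤ dirVariation f h := by
  have hc : Continuous fun z : E d × ℝ => fderiv ℝ f (z.1 + z.2 • h) h :=
    (continuous_fderiv_uncurry hf).comp (f := fun z : E d × ℝ => (z.1 + z.2 • h, h)) (by fun_prop)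
  calc shiftVariation f h
      ≤ ∫⁻ x : E d, ∫⁻ s in Ioc (0 : ℝ) 1, ‖fderiv ℝ f (x + s • h) h‖ₑ :=
        lintegral_mono fun x => enorm_sub_le_lintegral_fderiv hf x h
    _ = ∫⁻ s in Ioc (0 : ℝ) 1, ∫⁻ x : E d, ‖fderiv ℝ f (x + s • h) h‖ₑ :=
        lintegral_lintegral_swap hc.measurable.enorm.aemeasurable
    _ = ∫⁻ s in Ioc (0 : ℝ) 1, dirVariation f h :=
        lintegral_congr fun s => lintegral_add_right_eq_self (fun x => ‖fderiv ℝ f x h‖ₑ) (s • h)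
    _ = dirVariation f h := by simp

/-- Fatou for difference quotients; only this inequality is needed, so no domination is required. -/
lemma dirVariation_le_liminf {f : E d → ℝ} (hf : ContDiff ℝ 1 f) (h : E d) :
    dirVariation f h
      ≤ liminf (fun s : ℝ => shiftVariation f (s • h) / ENNReal.ofReal s) (𝓝[>] 0) := by
  have hm : Measurable f := hf.continuous.measurable
  have key : ∀ x, liminf (fun s : ℝ => ‖s⁻¹ • (f (x + s • h) - f x)‖ₑ) (𝓝[>] 0)
      = ‖fderiv ℝ f x h‖ₑ := fun x => by
    have h1 := (((hf.differentiable one_ne_zero) x).hasFDerivAt.hasLineDerivAt h)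
    have h2 := (HasDerivAt.tendsto_slope_zero_right h1)
    simp only [zero_add, zero_smul, add_zero] at h2
    exact h2.enorm.liminf_eq
  calc dirVariation f h
      = ∫⁻ x, liminf (fun s : ℝ => ‖s⁻¹ • (f (x + s • h) - f x)‖ₑ) (𝓝[>] 0) := by
        simp_rw [key]; rfl
    _ ≤ liminf (fun s : ℝ => ∫⁻ x, ‖s⁻¹ • (f (x + s • h) - f x)‖ₑ) (𝓝[>] 0) :=
        lintegral_liminf_le fun s => by fun_prop
    _ = _ := by
        refine liminf_congr ?_
        filter_upwards [self_mem_nhdsWithin] with s hs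
        have hs0 : (0 : ℝ) < s := hs
        simp only [smul_eq_mul, enorm_mul]
        rw [lintegral_const_mul' _ _ enorm_ne_top, shiftVariation, div_eq_mul_inv, mul_comm,
          enorm_inv hs0.ne', Real.enorm_of_nonneg hs0.le]

end Variation

/-! ### Integration by parts and duality with vector fields. -/

section Divergence

variable {d : ℕ}

lemma continuous_divergence {φ : E d → E d} (hφ : ContDiff ℝ 1 φ) : Continuous (divergence φ) := by
  unfold divergence
  have := hφ.continuous_fderiv one_ne_zero
  fun_prop

lemma hasCompactSupport_divergence {φ : E d → E d} (hc : HasCompactSupport φ) :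
    HasCompactSupport (divergence φ) :=
  (hc.fderiv ℝ).mono fun x hx h => hx (by simp [divergence, h])

lemma integrable_divergence {φ : E d → E d} (hφ : ContDiff ℝ 1 φ) (hc : HasCompactSupport φ) :
    Integrable (divergence φ) :=
  (continuous_divergence hφ).integrable_of_hasCompactSupport (hasCompactSupport_divergence hc)

lemma divergence_comp_add_right (φ : E d → E d) (t x : E d) :
    divergence (fun y => φ (y + t)) x = divergence φ (x + t) := by
  simp [divergence, fderiv_comp_add_right]

lemma integral_mul_divergence {f : E d → ℝ} (hf : ContDiff ℝ 1 f) {φ : E d → E d}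
    (hφ : ContDiff ℝ 1 φ) (hc : HasCompactSupport φ) :
    ∫ x, f x * divergence φ x = -∫ x, fderiv ℝ f x (φ x) := by
  have hcomp : ∀ i : Fin d, ContDiff ℝ 1 fun x => φ x i := fun i => by fun_prop
  have hcs : ∀ i : Fin d, HasCompactSupport fun x => φ x i := fun i =>
    hc.mono fun x hx h => hx (by simp [h])
  have hdf : ∀ (i : Fin d) (x v : E d), (fderiv ℝ φ x v) i = fderiv ℝ (fun y => φ y i) x v :=
    fun i x v => by
      have h1 := (EuclideanSpace.proj (𝕜 := ℝ) i).hasFDerivAt.comp x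
        ((hφ.differentiable one_ne_zero) x).hasFDerivAt
      have h2 : fderiv ℝ (fun y => φ y i) x = _ := h1.fderiv
      rw [h2]
      rfl
  have cf := hf.continuous
  have cf' := hf.continuous_fderiv one_ne_zero
  have ci := fun i => (hcomp i).continuous
  have ci' := fun i => (hcomp i).continuous_fderiv one_ne_zero
  have i1 : ∀ i, Integrable fun x => f x * fderiv ℝ (fun y => φ y i) x (EuclideanSpace.single i 1) :=
    fun i => (cf.mul ((ci' i).clm_apply continuous_const)).integrable_of_hasCompactSupport
      (((hcs i).fderiv ℝ).mono fun x hx h => hx (by simp [h]))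
  have i2 : ∀ i, Integrable fun x => fderiv ℝ f x (EuclideanSpace.single i 1) * φ x i :=
    fun i => ((cf'.clm_apply continuous_const).mul (ci i)).integrable_of_hasCompactSupport
      ((hcs i).mono fun x hx h => hx (by simp [h]))
  have i3 : ∀ i, Integrable fun x => f x * φ x i :=
    fun i => (cf.mul (ci i)).integrable_of_hasCompactSupport
      ((hcs i).mono fun x hx h => hx (by simp [h]))
  have hsum : ∀ x, fderiv ℝ f x (φ x)
      = ∑ i, fderiv ℝ f x (EuclideanSpace.single i 1) * φ x i := fun x => by
    conv_lhs => rw [← (EuclideanSpace.basisFun (Fin d) ℝ).sum_repr (φ x)]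
    simp [map_sum, mul_comm]
  simp_rw [hsum, divergence, hdf, Finset.mul_sum]
  rw [integral_finsetSum _ fun i _ => i1 i, integral_finsetSum _ fun i _ => i2 i,
    ← Finset.sum_neg_distrib]
  exact Finset.sum_congr rfl fun i _ => integral_mul_fderiv_eq_neg_fderiv_mul_of_integrable
    (i2 i) (i1 i) (i3 i) (fun x _ => hf.differentiable one_ne_zero x)
    (fun x _ => (hcomp i).differentiable one_ne_zero x)

lemma integral_divergence_le_perimeter {Ω : Set (E d)} (hP : perimeter Ω < ∞) {φ : E d → E d}
    (hφ : ContDiff ℝ 1 φ) (hc : HasCompactSupport φ) (h1 : ∀ x, ‖φ x‖ ≤ 1) :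
    ∫ x in Ω, divergence φ x ≤ (perimeter Ω).toReal := by
  rw [← ENNReal.ofReal_le_iff_le_toReal hP.ne]
  exact le_iSup_of_le φ (le_iSup_of_le hφ (le_iSup_of_le hc (le_iSup_of_le h1 le_rfl)))

/-- Duality: a smooth function whose distributional gradient has mass at most `P` against all
admissible fields has `L¹` norm of the gradient at most `P`. -/
lemma lintegral_gradient_le {f : E d → ℝ} (hf : ContDiff ℝ 2 f) (hc : HasCompactSupport f) {P : ℝ}
    (hP : ∀ φ : E d → E d, ContDiff ℝ 1 φ → HasCompactSupport φ → (∀ x, ‖φ x‖ ≤ 1) →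
      ∫ x, f x * divergence φ x ≤ P) :
    ∫⁻ x, ‖gradient f x‖ₑ ≤ ENNReal.ofReal P := by
  set G : E d → E d := gradient f with hG
  have hG1 : ContDiff ℝ 1 G :=
    (InnerProductSpace.toDual ℝ (E d)).symm.contDiff.comp (hf.fderiv_right (m := 1) (by norm_num))
  have hGc : HasCompactSupport G :=
    (hc.fderiv ℝ).mono fun x hx h => hx (by simp [hG, gradient, h])
  have hfG : ∀ x v, fderiv ℝ f x v = inner ℝ (G x) v := fun x v => by
    simp [hG, gradient]
  -- The optimal field `-∇f/|∇f|` is singular at critical points. Replacing `|∇f|` by `√(δ² +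
  -- |∇f|²)` gives an admissible `C¹` field, and Fatou removes `δ`.
  set δ : ℕ → ℝ := fun n => 1 / ((n : ℝ) + 1) with hδ
  have hδ0 : ∀ n, 0 < δ n := fun n => by simp only [hδ]; positivity
  set w : ℕ → E d → ℝ := fun n x => √(δ n ^ 2 + ‖G x‖ ^ 2) with hw
  have hw0 : ∀ n x, 0 < w n x := fun n x => Real.sqrt_pos.2 (by have := hδ0 n; positivity)
  have hwC : ∀ n, ContDiff ℝ 1 (w n) := fun n =>
    (contDiff_const.add (hG1.norm_sq ℝ)).sqrt fun x => by have := hδ0 n; positivity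
  have hGw : ∀ n x, ‖G x‖ ≤ w n x := fun n x =>
    Real.le_sqrt_of_sq_le (by have := sq_nonneg (δ n); linarith)
  have step : ∀ n, ∫⁻ x, ENNReal.ofReal (‖G x‖ ^ 2 / w n x) ≤ ENNReal.ofReal P := fun n => by
    have hφ1 : ContDiff ℝ 1 fun x => -((w n x)⁻¹ • G x) :=
      (((hwC n).inv fun x => (hw0 n x).ne').smul hG1).neg
    have hφc : HasCompactSupport fun x => -((w n x)⁻¹ • G x) :=
      hGc.mono fun x hx h => hx (by simp [h])
    have h := hP _ hφ1 hφc fun x => by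
      rw [norm_neg, norm_smul, norm_inv, Real.norm_of_nonneg (hw0 n x).le, inv_mul_le_one₀ (hw0 n x)]
      exact hGw n x
    rw [integral_mul_divergence (hf.of_le (by norm_num)) hφ1 hφc, ← integral_neg] at h
    have e : ∀ x, -fderiv ℝ f x (-((w n x)⁻¹ • G x)) = ‖G x‖ ^ 2 / w n x := fun x => by
      rw [map_neg, neg_neg, map_smul, hfG, real_inner_self_eq_norm_sq, smul_eq_mul, div_eq_inv_mul]
    simp_rw [e] at h
    rw [← ofReal_integral_eq_lintegral_ofReal]
    · exact ENNReal.ofReal_le_ofReal h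
    · refine Continuous.integrable_of_hasCompactSupport ?_ (hGc.mono fun x hx h => hx (by simp [h]))
      exact (hG1.continuous.norm.pow 2).div (hwC n).continuous fun x => (hw0 n x).ne'
    · exact ae_of_all _ fun x => div_nonneg (sq_nonneg _) (hw0 n x).le
  have lim : ∀ x, liminf (fun n => ENNReal.ofReal (‖G x‖ ^ 2 / w n x)) atTop = ‖G x‖ₑ := fun x => by
    by_cases hx : G x = 0
    · simp [hx]
    · have hd0 : Tendsto δ atTop (𝓝 0) := tendsto_one_div_add_atTop_nhds_zero_nat
      have h1 : Tendsto (fun n => w n x) atTop (𝓝 ‖G x‖) := by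
        have := ((hd0.pow 2).add_const (‖G x‖ ^ 2)).sqrt
        simpa [hw] using this
      have h2 := (tendsto_const_nhds (x := ‖G x‖ ^ 2)).div h1 (norm_ne_zero_iff.2 hx)
      rw [pow_two, mul_self_div_self] at h2
      rw [← ofReal_norm]
      simpa [pow_two] using (ENNReal.tendsto_ofReal h2).liminf_eq
  calc ∫⁻ x, ‖G x‖ₑ = ∫⁻ x, liminf (fun n => ENNReal.ofReal (‖G x‖ ^ 2 / w n x)) atTop := by
        simp_rw [lim]
    _ ≤ liminf (fun n => ∫⁻ x, ENNReal.ofReal (‖G x‖ ^ 2 / w n x)) atTop :=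
        lintegral_liminf_le fun n => by
          have := (hwC n).continuous.measurable
          have := hG1.continuous.measurable
          fun_prop
    _ ≤ ENNReal.ofReal P := liminf_le_of_frequently_le' (Frequently.of_forall step)

end Divergence

/-! ### Mollified indicators: smooth approximation of the perimeter. -/

section Mollification

open scoped Convolution

variable {d : ℕ}

/-- The indicator function of `Ω`, mollified by a normalized bump function. -/
def mollify (ρ : ContDiffBump (0 : E d)) (Ω : Set (E d)) : E d → ℝ :=
  ρ.normed volume ⋆[ContinuousLinearMap.lsmul ℝ ℝ, volume] Ω.indicator (fun _ => (1 : ℝ))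

lemma mollify_apply (ρ : ContDiffBump (0 : E d)) (Ω : Set (E d)) (x : E d) :
    mollify ρ Ω x = ∫ t, ρ.normed volume t * Ω.indicator (fun _ => (1 : ℝ)) (x - t) := rfl

lemma integrable_indicator_one {Ω : Set (E d)} (hΩ : MeasurableSet Ω)
    (hb : Bornology.IsBounded Ω) : Integrable (Ω.indicator fun _ => (1 : ℝ)) :=
  (integrable_indicator_iff hΩ).2 (integrableOn_const hb.measure_lt_top.ne)

lemma contDiff_mollify (ρ : ContDiffBump (0 : E d)) {Ω : Set (E d)} (hΩ : MeasurableSet Ω)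
    (hb : Bornology.IsBounded Ω) (n : ℕ) : ContDiff ℝ n (mollify ρ Ω) :=
  ρ.hasCompactSupport_normed.contDiff_convolution_left (n := n) _ ρ.contDiff_normed
    (integrable_indicator_one hΩ hb).locallyIntegrable

lemma hasCompactSupport_mollify (ρ : ContDiffBump (0 : E d)) {Ω : Set (E d)}
    (hb : Bornology.IsBounded Ω) : HasCompactSupport (mollify ρ Ω) := by
  refine HasCompactSupport.convolution _ ρ.hasCompactSupport_normed ?_
  exact HasCompactSupport.intro hb.isCompact_closure fun x hx =>
    indicator_of_notMem (fun h => hx (subset_closure h)) _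

lemma lintegral_enorm_normed (ρ : ContDiffBump (0 : E d)) :
    ∫⁻ t, ‖ρ.normed volume t‖ₑ = 1 := by
  have h := ofReal_integral_eq_lintegral_ofReal (ρ.integrable_normed (μ := volume))
    (ae_of_all _ ρ.nonneg_normed)
  rw [ρ.integral_normed, ENNReal.ofReal_one] at h
  rw [h]
  exact lintegral_congr fun t => Real.enorm_of_nonneg (ρ.nonneg_normed t)

lemma integrable_normed_mul_indicator (ρ : ContDiffBump (0 : E d)) {Ω : Set (E d)}
    (hΩ : MeasurableSet Ω) (x : E d) :
    Integrable fun t => ρ.normed volume t * Ω.indicator (fun _ => (1 : ℝ)) (x - t) := by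
  have hm : Measurable (Ω.indicator fun _ => (1 : ℝ)) := measurable_const.indicator hΩ
  refine (ρ.integrable_normed (μ := volume)).mono
    (ρ.continuous_normed.aestronglyMeasurable.mul
      (hm.comp (measurable_const_sub x)).aestronglyMeasurable) (ae_of_all _ fun t => ?_)
  rw [norm_mul]
  refine mul_le_of_le_one_right (norm_nonneg _) ?_
  by_cases h : x - t ∈ Ω <;> simp [h]

lemma abs_mollify_le (ρ : ContDiffBump (0 : E d)) (Ω : Set (E d)) (x : E d) :
    ‖mollify ρ Ω x‖ ≤ 1 := by
  rw [mollify_apply]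
  refine (norm_integral_le_of_norm_le ρ.integrable_normed (ae_of_all _ fun t => ?_)).trans_eq
    ρ.integral_normed
  rw [norm_mul, Real.norm_of_nonneg (ρ.nonneg_normed t)]
  refine mul_le_of_le_one_right (ρ.nonneg_normed t) ?_
  by_cases h : x - t ∈ Ω <;> simp [h]

/-- The mollified function is an average of translates with total weight 1, and the shift modulus is
convex and translation invariant. -/
lemma shiftVariation_mollify_le (ρ : ContDiffBump (0 : E d)) {Ω : Set (E d)}
    (hΩ : MeasurableSet Ω) (h : E d) :
    shiftVariation (mollify ρ Ω) h ≤ shiftVariation (Ω.indicator fun _ => (1 : ℝ)) h := by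
  set χ : E d → ℝ := Ω.indicator fun _ => (1 : ℝ) with hχ
  have hm : Measurable χ := measurable_const.indicator hΩ
  have hρ : Measurable (ρ.normed volume) := ρ.continuous_normed.measurable
  calc shiftVariation (mollify ρ Ω) h
      ≤ ∫⁻ x, ∫⁻ t, ‖ρ.normed volume t‖ₑ * ‖χ (x - t + h) - χ (x - t)‖ₑ := by
        refine lintegral_mono fun x => ?_
        rw [mollify_apply, mollify_apply, ← integral_sub (integrable_normed_mul_indicator ρ hΩ _)
          (integrable_normed_mul_indicator ρ hΩ _)]
        refine (enorm_integral_le_lintegral_enorm _).trans_eq (lintegral_congr fun t => ?_)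
        rw [← mul_sub, enorm_mul, add_sub_right_comm]
    _ = ∫⁻ t, ∫⁻ x, ‖ρ.normed volume t‖ₑ * ‖χ (x - t + h) - χ (x - t)‖ₑ :=
        lintegral_lintegral_swap (by fun_prop)
    _ = ∫⁻ t, ‖ρ.normed volume t‖ₑ * shiftVariation χ h := by
        refine lintegral_congr fun t => ?_
        rw [lintegral_const_mul' _ _ enorm_ne_top,
          lintegral_sub_right_eq_self (fun x => ‖χ (x + h) - χ x‖ₑ) t]
        rfl
    _ = shiftVariation χ h := by
        rw [lintegral_mul_const _ hρ.enorm, lintegral_enorm_normed, one_mul]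

/-- Fubini moves the mollifier onto the field: the integral becomes an average over `t` of the flux
through `Ω` of `φ(· + t)`, and translates of admissible fields are admissible. -/
lemma integral_mollify_mul_divergence_le (ρ : ContDiffBump (0 : E d)) {Ω : Set (E d)}
    (hΩ : MeasurableSet Ω) (hP : perimeter Ω < ∞) {φ : E d → E d}
    (hφ : ContDiff ℝ 1 φ) (hc : HasCompactSupport φ) (h1 : ∀ x, ‖φ x‖ ≤ 1) :
    ∫ x, mollify ρ Ω x * divergence φ x ≤ (perimeter Ω).toReal := by
  set χ : E d → ℝ := Ω.indicator fun _ => (1 : ℝ) with hχ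
  have hm : Measurable χ := measurable_const.indicator hΩ
  have hρ : Measurable (ρ.normed volume) := ρ.continuous_normed.measurable
  have hdiv := (continuous_divergence hφ).measurable
  have hint : Integrable (Function.uncurry fun x t : E d =>
      ρ.normed volume t * χ (x - t) * divergence φ x) (volume.prod volume) := by
    refine ((integrable_divergence hφ hc).mul_prod (ρ.integrable_normed (μ := volume))).mono
      (by fun_prop) (ae_of_all _ fun z => ?_)
    simp only [Function.uncurry, norm_mul]
    rw [mul_comm ‖divergence φ z.1‖]
    gcongr
    refine mul_le_of_le_one_right (norm_nonneg _) ?_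
    by_cases h : z.1 - z.2 ∈ Ω <;> simp [hχ, h]
  have hinner : ∀ t, ∫ x, ρ.normed volume t * χ (x - t) * divergence φ x
      = ρ.normed volume t * ∫ x in Ω, divergence (fun y => φ (y + t)) x := fun t => by
    simp only [mul_assoc]
    rw [integral_const_mul, ← integral_indicator hΩ,
      ← integral_add_right_eq_self (fun x => χ (x - t) * divergence φ x) t]
    congr 2
    ext x
    by_cases h : x ∈ Ω <;> simp [hχ, h, divergence_comp_add_right φ t x]
  have hswap : ∫ x, mollify ρ Ω x * divergence φ x
      = ∫ t, ρ.normed volume t * ∫ x in Ω, divergence (fun y => φ (y + t)) x := by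
    calc ∫ x, mollify ρ Ω x * divergence φ x
        = ∫ x, ∫ t, ρ.normed volume t * χ (x - t) * divergence φ x := by
          refine integral_congr_ae (ae_of_all _ fun x => ?_)
          simp only [mollify_apply]
          exact (integral_mul_const _ _).symm
      _ = ∫ t, ∫ x, ρ.normed volume t * χ (x - t) * divergence φ x := integral_integral_swap hint
      _ = _ := integral_congr_ae (ae_of_all _ hinner)
  have hint2 : Integrable fun t =>
      ρ.normed volume t * ∫ x in Ω, divergence (fun y => φ (y + t)) x :=
    hint.integral_prod_right.congr (ae_of_all _ hinner)
  rw [hswap]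
  calc ∫ t, ρ.normed volume t * ∫ x in Ω, divergence (fun y => φ (y + t)) x
      ≤ ∫ t, ρ.normed volume t * (perimeter Ω).toReal := by
        refine integral_mono hint2 (ρ.integrable_normed.mul_const _) fun t => ?_
        refine mul_le_mul_of_nonneg_left ?_ (ρ.nonneg_normed t)
        exact integral_divergence_le_perimeter hP (hφ.comp (contDiff_id.add contDiff_const))
          (hc.comp_homeomorph (Homeomorph.addRight t)) fun x => h1 _
    _ = (perimeter Ω).toReal := by rw [integral_mul_const, ρ.integral_normed, one_mul]

lemma lintegral_gradient_mollify_le (ρ : ContDiffBump (0 : E d)) {Ω : Set (E d)}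
    (hΩ : MeasurableSet Ω) (hb : Bornology.IsBounded Ω) (hP : perimeter Ω < ∞) :
    ∫⁻ x, ‖gradient (mollify ρ Ω) x‖ₑ ≤ perimeter Ω := by
  rw [← ENNReal.ofReal_toReal hP.ne]
  exact lintegral_gradient_le (contDiff_mollify ρ hΩ hb 2) (hasCompactSupport_mollify ρ hb)
    fun φ hφ hc h1 => integral_mollify_mul_divergence_le ρ hΩ hP hφ hc h1

/-- A sequence of bump functions shrinking to the origin. -/
def shrinkingBump (d k : ℕ) : ContDiffBump (0 : E d) where
  rIn := 1 / ((k : ℝ) + 1)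
  rOut := 2 * (1 / ((k : ℝ) + 1))
  rIn_pos := by positivity
  rIn_lt_rOut := by
    have : (0 : ℝ) < 1 / ((k : ℝ) + 1) := by positivity
    linarith

lemma ae_tendsto_mollify {Ω : Set (E d)} (hΩ : MeasurableSet Ω) (hb : Bornology.IsBounded Ω) :
    ∀ᵐ x : E d, Tendsto (fun k => mollify (shrinkingBump d k) Ω x) atTop
      (𝓝 (Ω.indicator (fun _ => (1 : ℝ)) x)) := by
  -- `2` is the fixed ratio of outer to inner radius of `shrinkingBump`; Lebesgue differentiation
  -- needs this ratio bounded.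
  refine ContDiffBump.ae_convolution_tendsto_right_of_locallyIntegrable (K := 2) ?_
    (Eventually.of_forall fun k => le_rfl) (integrable_indicator_one hΩ hb).locallyIntegrable
  simpa [shrinkingBump] using
    (tendsto_one_div_add_atTop_nhds_zero_nat (𝕜 := ℝ)).const_mul 2

lemma shiftVariation_le_liminf_dirVariation {Ω : Set (E d)} (hΩ : MeasurableSet Ω)
    (hb : Bornology.IsBounded Ω) (h : E d) :
    shiftVariation (Ω.indicator fun _ => (1 : ℝ)) h
      ≤ liminf (fun k => dirVariation (mollify (shrinkingBump d k) Ω) h) atTop := by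
  have hae := ae_tendsto_mollify hΩ hb
  have hae2 := (measurePreserving_add_right volume h).quasiMeasurePreserving.ae hae
  have hm : ∀ k, Measurable (mollify (shrinkingBump d k) Ω) := fun k =>
    (contDiff_mollify (shrinkingBump d k) hΩ hb 1).continuous.measurable
  calc shiftVariation (Ω.indicator fun _ => (1 : ℝ)) h
      = ∫⁻ x, liminf (fun k => ‖mollify (shrinkingBump d k) Ω (x + h)
          - mollify (shrinkingBump d k) Ω x‖ₑ) atTop := by
        refine lintegral_congr_ae ?_
        filter_upwards [hae, hae2] with x h1 h2
        exact (h2.sub h1).enorm.liminf_eq.symm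
    _ ≤ liminf (fun k => shiftVariation (mollify (shrinkingBump d k) Ω) h) atTop :=
        lintegral_liminf_le fun k => by have := hm k; fun_prop
    _ ≤ _ := liminf_le_liminf (Eventually.of_forall fun k =>
        shiftVariation_le_dirVariation (contDiff_mollify _ hΩ hb 1) h)

lemma dirVariation_mollify_le_liminf (ρ : ContDiffBump (0 : E d)) {Ω : Set (E d)}
    (hΩ : MeasurableSet Ω) (hb : Bornology.IsBounded Ω) (h : E d) :
    dirVariation (mollify ρ Ω) h ≤ liminf (fun s : ℝ =>
      shiftVariation (Ω.indicator fun _ => (1 : ℝ)) (s • h) / ENNReal.ofReal s) (𝓝[>] 0) :=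
  (dirVariation_le_liminf (contDiff_mollify ρ hΩ hb 1) h).trans
    (liminf_le_liminf (Eventually.of_forall fun s => by
      gcongr; exact shiftVariation_mollify_le ρ hΩ _))

/-- Lower semicontinuity: the integral of `div φ` over `Ω` is the limit of its integrals against the
mollifications, and each of these is bounded by `∫ |∇f_k|` after integration by parts. -/
lemma perimeter_le_iSup_gradient {Ω : Set (E d)} (hΩ : MeasurableSet Ω)
    (hb : Bornology.IsBounded Ω) :
    perimeter Ω ≤ ⨆ k, ∫⁻ x, ‖gradient (mollify (shrinkingBump d k) Ω) x‖ₑ := by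
  refine iSup_le fun φ => iSup_le fun hφ => iSup_le fun hc => iSup_le fun h1 => ?_
  have hlim : Tendsto (fun k => ∫ x, mollify (shrinkingBump d k) Ω x * divergence φ x) atTop
      (𝓝 (∫ x in Ω, divergence φ x)) := by
    have hlim0 : Tendsto (fun k => ∫ x, mollify (shrinkingBump d k) Ω x * divergence φ x) atTop
      (𝓝 (∫ x, Ω.indicator (fun _ => (1 : ℝ)) x * divergence φ x)) := by
      refine tendsto_integral_of_dominated_convergence (fun x => ‖divergence φ x‖) (fun k => ?_)
        (integrable_divergence hφ hc).norm (fun k => ae_of_all _ fun x => ?_) ?_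
      · exact ((contDiff_mollify _ hΩ hb 1).continuous.mul
          (continuous_divergence hφ)).aestronglyMeasurable
      · rw [norm_mul]
        exact mul_le_of_le_one_left (norm_nonneg _) (abs_mollify_le _ _ _)
      · filter_upwards [ae_tendsto_mollify hΩ hb] with x hx
        exact hx.mul_const _
    convert hlim0 using 2
    rw [← integral_indicator hΩ]
    congr 1
    ext x
    by_cases h : x ∈ Ω <;> simp [h]
  refine le_of_tendsto' (ENNReal.tendsto_ofReal hlim) fun k => ?_
  rw [integral_mul_divergence (contDiff_mollify _ hΩ hb 1) hφ hc]
  refine le_trans ?_ (le_iSup _ k)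
  refine (Real.ofReal_le_enorm _).trans ?_
  rw [enorm_neg]
  refine (enorm_integral_le_lintegral_enorm _).trans (lintegral_mono fun x => ?_)
  have : fderiv ℝ (mollify (shrinkingBump d k) Ω) x (φ x)
      = inner ℝ (gradient (mollify (shrinkingBump d k) Ω) x) (φ x) := by simp [gradient]
  simp only [this, ← ofReal_norm]
  exact ENNReal.ofReal_le_ofReal ((norm_inner_le_norm _ _).trans
    (mul_le_of_le_one_right (norm_nonneg _) (h1 x)))

end Mollification

lemma mul_liminf_le {ι : Type*} {l : Filter ι} [NeBot l] (c : ℝ≥0∞) (v : ι → ℝ≥0∞) :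
    c * liminf v l ≤ liminf (fun i => c * v i) l := by
  simpa using! ENNReal.le_liminf_mul (u := fun _ => c) (v := v) (f := l)

/-! ### First-order bounds for the averaged shift modulus. -/

section Asymptotics

variable {d : ℕ}

/-- The first moment `∫ q(z) |z · u| dz` of a radial function in a unit direction `u`. -/
def dirMoment (q : E d → ℝ≥0∞) : ℝ≥0∞ :=
  ENNReal.ofReal (2 * ballVol (d - 1)) *
    ∫⁻ r in Ioi (0 : ℝ), ENNReal.ofReal (r ^ d) * q (r • lastVec d)

/-- After Tonelli the integral in `z` is the moment of `q` in the direction of the gradient, which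
by rotation invariance sees only its length. -/
lemma lintegral_mul_dirVariation (hd : 1 ≤ d) {q : E d → ℝ≥0∞} (hq : AEMeasurable q volume)
    (hr : ∀ x y : E d, ‖x‖ = ‖y‖ → q x = q y) {f : E d → ℝ} (hf : ContDiff ℝ 1 f) :
    ∫⁻ z, q z * dirVariation f z = dirMoment q * ∫⁻ x, ‖gradient f x‖ₑ := by
  have hc := continuous_fderiv_uncurry hf
  have hG : Measurable fun x => ‖gradient f x‖ₑ := by
    have : Continuous (gradient f) := (InnerProductSpace.toDual ℝ (E d)).symm.continuous.comp
      (hf.continuous_fderiv one_ne_zero)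
    exact this.measurable.enorm
  calc ∫⁻ z, q z * dirVariation f z = ∫⁻ z, ∫⁻ x, q z * ‖fderiv ℝ f x z‖ₑ :=
        lintegral_congr fun z => (lintegral_const_mul'' _ (by
          have : Continuous fun x => fderiv ℝ f x z := hc.comp (f := fun x => (x, z)) (by fun_prop)
          exact this.measurable.enorm.aemeasurable)).symm
    _ = ∫⁻ x, ∫⁻ z, q z * ‖fderiv ℝ f x z‖ₑ :=
        lintegral_lintegral_swap (hq.comp_fst.mul
          (hc.comp continuous_swap).measurable.enorm.aemeasurable)
    _ = ∫⁻ x, ‖gradient f x‖ₑ * dirMoment q := lintegral_congr fun x => by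
        have : ∀ z, fderiv ℝ f x z = inner ℝ (gradient f x) z := fun z => by simp [gradient]
        simp_rw [this]
        exact lintegral_radial_mul_inner hd hq hr _
    _ = _ := by rw [lintegral_mul_const _ hG, mul_comm]

lemma lintegral_mul_shiftVariation_le (hd : 1 ≤ d) {q : E d → ℝ≥0∞} (hq : AEMeasurable q volume)
    (hr : ∀ x y : E d, ‖x‖ = ‖y‖ → q x = q y) {Ω : Set (E d)} (hΩ : MeasurableSet Ω)
    (hb : Bornology.IsBounded Ω) (hP : perimeter Ω < ∞) {s : ℝ} (hs : 0 < s) :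
    ∫⁻ z, q z * shiftVariation (Ω.indicator fun _ => (1 : ℝ)) (s • z)
      ≤ ENNReal.ofReal s * (dirMoment q * perimeter Ω) := by
  set f : ℕ → E d → ℝ := fun k => mollify (shrinkingBump d k) Ω with hf
  have hfC : ∀ k, ContDiff ℝ 1 (f k) := fun k => contDiff_mollify _ hΩ hb 1
  calc ∫⁻ z, q z * shiftVariation (Ω.indicator fun _ => (1 : ℝ)) (s • z)
      ≤ ∫⁻ z, liminf (fun k => q z * dirVariation (f k) (s • z)) atTop :=
        lintegral_mono fun z => (mul_le_mul_right
          (shiftVariation_le_liminf_dirVariation hΩ hb _) _).trans (mul_liminf_le _ _)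
    _ ≤ liminf (fun k => ∫⁻ z, q z * dirVariation (f k) (s • z)) atTop :=
        lintegral_liminf_le' fun k => hq.mul
          ((measurable_dirVariation (hfC k)).comp (measurable_const_smul s)).aemeasurable
    _ ≤ ENNReal.ofReal s * (dirMoment q * perimeter Ω) := by
        refine liminf_le_of_frequently_le' (Frequently.of_forall fun k => ?_)
        simp_rw [dirVariation_smul, mul_left_comm (q _)]
        rw [lintegral_const_mul' _ _ enorm_ne_top, lintegral_mul_dirVariation hd hq hr (hfC k),
          Real.enorm_of_nonneg hs.le]
        gcongr
        exact lintegral_gradient_mollify_le _ hΩ hb hP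

/-- The mollifier is kept fixed while `s → 0`, so Fatou in `s` suffices; the supremum over
mollifiers comes outside. -/
lemma dirMoment_mul_perimeter_le_liminf (hd : 1 ≤ d) {q : E d → ℝ≥0∞}
    (hq : AEMeasurable q volume)
    (hr : ∀ x y : E d, ‖x‖ = ‖y‖ → q x = q y) {Ω : Set (E d)} (hΩ : MeasurableSet Ω)
    (hb : Bornology.IsBounded Ω) :
    dirMoment q * perimeter Ω ≤ liminf (fun s : ℝ =>
      (∫⁻ z, q z * shiftVariation (Ω.indicator fun _ => (1 : ℝ)) (s • z)) / ENNReal.ofReal s)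
        (𝓝[>] 0) := by
  have hm : Measurable (Ω.indicator fun _ => (1 : ℝ)) := measurable_const.indicator hΩ
  have hmeas : ∀ s : ℝ, Measurable fun z =>
      shiftVariation (Ω.indicator fun _ => (1 : ℝ)) (s • z) / ENNReal.ofReal s := fun s =>
    ((measurable_shiftVariation hm).comp (measurable_const_smul s)).div_const _
  refine (mul_le_mul_right (perimeter_le_iSup_gradient hΩ hb) _).trans ?_
  rw [ENNReal.mul_iSup]
  refine iSup_le fun k => ?_
  rw [← lintegral_mul_dirVariation hd hq hr (contDiff_mollify _ hΩ hb 1)]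
  calc ∫⁻ z, q z * dirVariation (mollify (shrinkingBump d k) Ω) z
      ≤ ∫⁻ z, liminf (fun s : ℝ => q z * (shiftVariation (Ω.indicator fun _ => (1 : ℝ)) (s • z)
          / ENNReal.ofReal s)) (𝓝[>] 0) :=
        lintegral_mono fun z => (mul_le_mul_right
          (dirVariation_mollify_le_liminf _ hΩ hb z) _).trans (mul_liminf_le _ _)
    _ ≤ liminf (fun s : ℝ => ∫⁻ z, q z * (shiftVariation (Ω.indicator fun _ => (1 : ℝ)) (s • z)
          / ENNReal.ofReal s)) (𝓝[>] 0) :=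
        lintegral_liminf_le' fun s => hq.mul (hmeas s).aemeasurable
    _ = _ := by
        refine liminf_congr ?_
        filter_upwards [self_mem_nhdsWithin] with s hs
        simp_rw [div_eq_mul_inv, ← mul_assoc]
        rw [lintegral_mul_const' _ _
          (ENNReal.inv_ne_top.2 (ENNReal.ofReal_pos.2 hs).ne')]

end Asymptotics

/-! ### The heat deficit as an averaged shift modulus. -/

section HeatLoss

variable {d : ℕ}

lemma lintegral_comp_smul (F : E d → ℝ≥0∞) {c : ℝ} (hc : 0 < c) :
    ∫⁻ x, F (c • x) = ENNReal.ofReal (c ^ d)⁻¹ * ∫⁻ x, F x := by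
  have h := Measure.map_addHaar_smul (volume : Measure (E d)) hc.ne'
  rw [finrank_euclideanSpace, Fintype.card_fin, abs_of_nonneg (by positivity)] at h
  have h2 := ((Homeomorph.smulOfNeZero c hc.ne').measurableEmbedding).lintegral_map
    (μ := (volume : Measure (E d))) F
  change ∫⁻ x, F x ∂(Measure.map (fun x => c • x) volume) = _ at h2
  rw [h, lintegral_smul_measure] at h2
  exact h2.symm

lemma aemeasurable_comp_sub {F : E d → ℝ≥0∞} (hF : AEMeasurable F volume) (A B : Set (E d)) :
    AEMeasurable (fun z : E d × E d => F (z.1 - z.2))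
      ((volume.restrict A).prod (volume.restrict B)) := by
  have h := hF.comp_quasiMeasurePreserving
    (quasiMeasurePreserving_sub_of_right_invariant volume volume)
  rw [Measure.prod_restrict]
  exact h.restrict

/-- The heat `∫_Ω ∫_{Ωᶜ} q(x - y) dy dx` exchanged between `Ω` and its complement. -/
def exchange (q : E d → ℝ≥0∞) (Ω : Set (E d)) : ℝ≥0∞ := ∫⁻ x in Ω, ∫⁻ y in Ωᶜ, q (x - y)

lemma lintegral_add_exchange {q : E d → ℝ≥0∞} (hq : AEMeasurable q volume) {Ω : Set (E d)}
    (hΩ : MeasurableSet Ω) :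
    (∫⁻ x in Ω, ∫⁻ y in Ω, q (x - y)) + exchange q Ω = volume Ω * ∫⁻ x, q x := by
  rw [exchange, ← lintegral_add_left' (aemeasurable_comp_sub hq Ω Ω).lintegral_prod_right']
  simp_rw [lintegral_add_compl _ hΩ, lintegral_sub_left_eq_self]
  simp [mul_comm]

/-- The modulus is the measure of the symmetric difference of `Ω` and a translate. Both have the
same finite measure, so the two one-sided differences are equal, whence the factor 2. -/
lemma shiftVariation_indicator {Ω : Set (E d)} (hΩ : MeasurableSet Ω) (hv : volume Ω ≠ ∞)
    (z : E d) :
    shiftVariation (Ω.indicator fun _ => (1 : ℝ)) z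
      = 2 * volume (Ω ∩ (fun x => x - z) ⁻¹' Ωᶜ) := by
  set T : Set (E d) := (fun x => x - z) ⁻¹' Ω with hT
  have hTm : MeasurableSet T := hΩ.preimage (measurable_sub_const z)
  have hTv : volume T = volume Ω :=
    (measurePreserving_sub_right volume z).measure_preimage hΩ.nullMeasurableSet
  have h1 := measure_sdiff_add_inter (μ := volume) Ω hTm
  have h2 := measure_sdiff_add_inter (μ := volume) T hΩ
  have hsymm : volume (T \ Ω) = volume (Ω \ T) := by
    rw [hTv, ← h1, inter_comm T Ω] at h2
    exact (ENNReal.add_left_inj (measure_ne_top_of_subset inter_subset_left hv)).1 h2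
  have hset : Ω ∩ (fun x => x - z) ⁻¹' Ωᶜ = Ω \ T := rfl
  rw [hset, shiftVariation, ← lintegral_sub_right_eq_self _ z, two_mul]
  nth_rw 1 [← hsymm]
  rw [← lintegral_indicator_one (hΩ.diff hTm), ← lintegral_indicator_one (hTm.diff hΩ),
    ← lintegral_add_left (measurable_one.indicator (hTm.diff hΩ))]
  refine lintegral_congr fun x => ?_
  simp only [sub_add_cancel]
  by_cases a : x ∈ Ω <;> by_cases b : x - z ∈ Ω <;> simp [indicator, hT, a, b]

lemma exchange_eq {q : E d → ℝ≥0∞} (hq : AEMeasurable q volume) {Ω : Set (E d)}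
    (hΩ : MeasurableSet Ω) (hv : volume Ω ≠ ∞) :
    2 * exchange q Ω = ∫⁻ z, q z * shiftVariation (Ω.indicator fun _ => (1 : ℝ)) z := by
  simp_rw [shiftVariation_indicator hΩ hv, mul_left_comm (q _)]
  rw [lintegral_const_mul' _ _ (by norm_num)]
  congr 1
  have hmeas : MeasurableSet {p : E d × E d | p.1 ∈ Ω ∧ p.1 - p.2 ∈ Ωᶜ} :=
    (hΩ.preimage measurable_fst).inter (hΩ.compl.preimage (measurable_fst.sub measurable_snd))
  calc exchange q Ω
      = ∫⁻ x, ∫⁻ z, {p : E d × E d | p.1 ∈ Ω ∧ p.1 - p.2 ∈ Ωᶜ}.indicator (fun p => q p.2) (x, z) := by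
        rw [exchange, ← lintegral_indicator hΩ]
        refine lintegral_congr fun x => ?_
        by_cases hx : x ∈ Ω
        · rw [indicator_of_mem hx, ← lintegral_indicator hΩ.compl, ← lintegral_sub_left_eq_self _ x]
          refine lintegral_congr fun z => ?_
          by_cases h : x - z ∈ Ω <;> simp [indicator, hx, h]
        · simp [indicator, hx]
    _ = ∫⁻ z, ∫⁻ x, {p : E d × E d | p.1 ∈ Ω ∧ p.1 - p.2 ∈ Ωᶜ}.indicator (fun p => q p.2) (x, z) :=
        lintegral_lintegral_swap (hq.comp_snd.indicator hmeas)
    _ = _ := by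
        refine lintegral_congr fun z => ?_
        have hm : MeasurableSet (Ω ∩ (fun x => x - z) ⁻¹' Ωᶜ) :=
          hΩ.inter (hΩ.compl.preimage (measurable_sub_const z))
        rw [← lintegral_indicator_one hm, ← lintegral_const_mul _ (measurable_one.indicator hm)]
        refine lintegral_congr fun x => ?_
        by_cases a : x ∈ Ω <;> by_cases b : x - z ∈ Ω <;> simp [indicator, a, b]

variable {β γ : ℝ} {p : ℝ → E d → ℝ≥0∞}

lemma IsHeatKernel.lintegral_mul (hp : IsHeatKernel β γ p) {t : ℝ} (ht : 0 < t) (F : E d → ℝ≥0∞) :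
    ∫⁻ x, p t x * F x
      = ENNReal.ofReal (t ^ (β + (d : ℝ) * γ)) * ∫⁻ x, p 1 x * F (t ^ γ • x) := by
  have hc : 0 < t ^ (-γ) := Real.rpow_pos_of_pos ht _
  have h := lintegral_comp_smul (fun x => p 1 x * F (t ^ γ • x)) hc
  simp_rw [smul_smul, ← Real.rpow_add ht, add_neg_cancel, Real.rpow_zero, one_smul] at h
  simp_rw [hp.scaling t ht, mul_assoc]
  rw [lintegral_const_mul' _ _ ENNReal.ofReal_ne_top, h, ← mul_assoc, ← ENNReal.ofReal_mul
    (Real.rpow_nonneg ht.le _), ← Real.rpow_mul_natCast ht.le, ← Real.rpow_neg ht.le,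
    ← Real.rpow_add ht]
  congr 4
  ring

lemma IsHeatKernel.lintegral_eq (hp : IsHeatKernel β γ p) {t : ℝ} (ht : 0 < t) :
    ∫⁻ x, p t x = ENNReal.ofReal (t ^ (β + (d : ℝ) * γ)) * ∫⁻ x, p 1 x := by
  simpa using hp.lintegral_mul ht fun _ => 1

/-- The shift variation of `Ω` averaged over the kernel `q` at scale `s`. -/
def averagedVariation (q : E d → ℝ≥0∞) (Ω : Set (E d)) (s : ℝ) : ℝ≥0∞ :=
  ∫⁻ z, q z * shiftVariation (Ω.indicator fun _ => (1 : ℝ)) (s • z)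

lemma averagedVariation_le (q : E d → ℝ≥0∞) {Ω : Set (E d)} (hΩ : MeasurableSet Ω)
    (hv : volume Ω ≠ ∞) (s : ℝ) : averagedVariation q Ω s ≤ 2 * volume Ω * ∫⁻ z, q z := by
  rw [← lintegral_const_mul' _ _ (ENNReal.mul_ne_top (by norm_num) hv)]
  refine lintegral_mono fun z => ?_
  rw [mul_comm, shiftVariation_indicator hΩ hv]
  gcongr
  exact inter_subset_left

lemma kernelNorm_mul_sub_heatContent (hp : IsHeatKernel β γ p) {Ω : Set (E d)}
    (hΩ : MeasurableSet Ω) (hv : volume Ω ≠ ∞) {t : ℝ} (ht : 0 < t) :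
    t ^ ((d : ℝ) * γ + β) * kernelNorm p * (volume Ω).toReal - (heatContent p Ω t).toReal
      = (exchange (p t) Ω).toReal := by
  have h := lintegral_add_exchange (hp.aemeasurable t ht) hΩ
  have hfin : volume Ω * ∫⁻ x, p t x ≠ ∞ := ENNReal.mul_ne_top hv (hp.lintegral_lt_top t ht).ne
  have hH : heatContent p Ω t ≠ ∞ := ne_top_of_le_ne_top hfin (h ▸ le_self_add)
  have hK : exchange (p t) Ω ≠ ∞ := ne_top_of_le_ne_top hfin (h ▸ le_add_self)
  have h2 : (heatContent p Ω t + exchange (p t) Ω).toReal = _ := congrArg ENNReal.toReal h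
  rw [ENNReal.toReal_add hH hK, hp.lintegral_eq ht, ENNReal.toReal_mul, ENNReal.toReal_mul,
    ENNReal.toReal_ofReal (Real.rpow_nonneg ht.le _)] at h2
  rw [kernelNorm, add_comm ((d : ℝ) * γ)]
  linarith

/-- The scaling of the kernel produces exactly the factor that normalizes the heat content, leaving
`t` only in the displacement `t^γ z`. -/
lemma deficit_eq (hp : IsHeatKernel β γ p) {Ω : Set (E d)}
    (hΩ : MeasurableSet Ω) (hv : volume Ω ≠ ∞) {t : ℝ} (ht : 0 < t) :
    deficit β γ p Ω t = (averagedVariation (p 1) Ω (t ^ γ)).toReal / 2 := by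
  have h1 := exchange_eq (hp.aemeasurable t ht) hΩ hv
  rw [hp.lintegral_mul ht] at h1
  have h2 := congrArg ENNReal.toReal h1
  have h3 := kernelNorm_mul_sub_heatContent hp hΩ hv ht
  have hpos : 0 < t ^ (β + (d : ℝ) * γ) := Real.rpow_pos_of_pos ht _
  rw [ENNReal.toReal_mul, ENNReal.toReal_mul, ENNReal.toReal_ofReal hpos.le] at h2
  change _ = _ * (averagedVariation (p 1) Ω (t ^ γ)).toReal at h2
  rw [add_comm ((d : ℝ) * γ)] at h3
  rw [deficit, Real.rpow_neg ht.le]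
  simp only [ENNReal.toReal_ofNat] at h2
  field_simp
  linear_combination 2 * h3 + h2

end HeatLoss

/-! ### Part (i): kernels with finite first moment. -/

section FiniteMoment

variable {d : ℕ} {β γ : ℝ} {p : ℝ → E d → ℝ≥0∞}

lemma dirMoment_eq (p : ℝ → E d → ℝ≥0∞) :
    dirMoment (p 1) = ENNReal.ofReal (2 * ballVol (d - 1)) * radialMoment p := rfl

lemma toReal_dirMoment (p : ℝ → E d → ℝ≥0∞) :
    (dirMoment (p 1)).toReal = 2 * ballVol (d - 1) * (radialMoment p).toReal := by
  rw [dirMoment_eq, ENNReal.toReal_mul, ENNReal.toReal_ofReal]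
  have := ballVol_pos (d - 1)
  positivity

lemma dirMoment_ne_top (hd : 1 ≤ d) (hp : IsHeatKernel β γ p)
    (hm : ∫⁻ x : E d, ENNReal.ofReal ‖x‖ * p 1 x < ∞) : dirMoment (p 1) ≠ ∞ := by
  -- Testing in the unit direction `e_d` writes the constant as `∫ p_1(x) |⟪e_d, x⟫| dx`, which
  -- Cauchy–Schwarz bounds by the first moment.
  have h := lintegral_radial_mul_inner hd (hp.aemeasurable 1 one_pos) (hp.radial 1 one_pos)
    (lastVec d)
  rw [← enorm_norm, norm_lastVec hd, enorm_one, one_mul] at h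
  change _ = dirMoment (p 1) at h
  rw [← h]
  refine ne_top_of_le_ne_top hm.ne (lintegral_mono fun x => ?_)
  rw [mul_comm, ← ofReal_norm]
  gcongr
  simpa [norm_lastVec hd] using norm_inner_le_norm (𝕜 := ℝ) (lastVec d) x

lemma averagedVariation_le_dirMoment (hd : 1 ≤ d) (hp : IsHeatKernel β γ p) {Ω : Set (E d)}
    (hΩ : MeasurableSet Ω) (hb : Bornology.IsBounded Ω) (hP : perimeter Ω < ∞) {s : ℝ}
    (hs : 0 < s) :
    averagedVariation (p 1) Ω s ≤ ENNReal.ofReal s * (dirMoment (p 1) * perimeter Ω) :=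
  lintegral_mul_shiftVariation_le hd (hp.aemeasurable 1 one_pos) (hp.radial 1 one_pos) hΩ hb hP hs

lemma deficit_le_of_moment (hd : 1 ≤ d) (hp : IsHeatKernel β γ p) {Ω : Set (E d)}
    (hΩ : MeasurableSet Ω) (hb : Bornology.IsBounded Ω) (hP : perimeter Ω < ∞)
    (hm : ∫⁻ x : E d, ENNReal.ofReal ‖x‖ * p 1 x < ∞) {t : ℝ} (ht : 0 < t) :
    deficit β γ p Ω t
      ≤ t ^ γ * ballVol (d - 1) * (perimeter Ω).toReal * (radialMoment p).toReal := by
  have hs : 0 < t ^ γ := Real.rpow_pos_of_pos ht _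
  have h := ENNReal.toReal_mono (ENNReal.mul_ne_top ENNReal.ofReal_ne_top
    (ENNReal.mul_ne_top (dirMoment_ne_top hd hp hm) hP.ne))
    (averagedVariation_le_dirMoment hd hp hΩ hb hP hs)
  rw [ENNReal.toReal_mul, ENNReal.toReal_mul, ENNReal.toReal_ofReal hs.le, toReal_dirMoment] at h
  rw [deficit_eq hp hΩ hb.measure_lt_top.ne ht]
  linarith

lemma tendsto_rpow_nhdsGT_zero {γ : ℝ} (hγ : 0 < γ) :
    Tendsto (fun t : ℝ => t ^ γ) (𝓝[>] 0) (𝓝[>] 0) := by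
  refine tendsto_nhdsWithin_iff.2 ⟨?_, ?_⟩
  · have := (Real.continuousAt_rpow_const 0 γ (Or.inr hγ.le)).tendsto
    rw [Real.zero_rpow hγ.ne'] at this
    exact this.mono_left nhdsWithin_le_nhds
  · filter_upwards [self_mem_nhdsWithin] with t ht
    exact Real.rpow_pos_of_pos ht _

lemma tendsto_deficit_of_moment (hd : 1 ≤ d) (hp : IsHeatKernel β γ p) {Ω : Set (E d)}
    (hΩ : MeasurableSet Ω) (hb : Bornology.IsBounded Ω) (hP : perimeter Ω < ∞)
    (hm : ∫⁻ x : E d, ENNReal.ofReal ‖x‖ * p 1 x < ∞) :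
    Tendsto (fun t : ℝ => deficit β γ p Ω t / t ^ γ) (𝓝[>] 0)
      (𝓝 (ballVol (d - 1) * (perimeter Ω).toReal * (radialMoment p).toReal)) := by
  have hfin : dirMoment (p 1) * perimeter Ω ≠ ∞ :=
    ENNReal.mul_ne_top (dirMoment_ne_top hd hp hm) hP.ne
  have h1 : Tendsto (fun s : ℝ => averagedVariation (p 1) Ω s / ENNReal.ofReal s) (𝓝[>] 0)
      (𝓝 (dirMoment (p 1) * perimeter Ω)) := by
    refine tendsto_of_le_liminf_of_limsup_le
      (dirMoment_mul_perimeter_le_liminf hd (hp.aemeasurable 1 one_pos) (hp.radial 1 one_pos) hΩ hb)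
      (limsup_le_of_le (h := ?_))
    filter_upwards [self_mem_nhdsWithin] with s hs
    have hs0 : (0 : ℝ) < s := hs
    rw [ENNReal.div_le_iff (ENNReal.ofReal_pos.2 hs0).ne' ENNReal.ofReal_ne_top, mul_comm]
    exact averagedVariation_le_dirMoment hd hp hΩ hb hP hs0
  have h2 := (((ENNReal.tendsto_toReal hfin).comp h1).comp
    (tendsto_rpow_nhdsGT_zero hp.gamma_pos)).div_const 2
  rw [ENNReal.toReal_mul, toReal_dirMoment] at h2
  convert h2.congr' ?_ using 2
  · ring
  · filter_upwards [self_mem_nhdsWithin] with t ht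
    have ht0 : (0 : ℝ) < t := ht
    have hs : 0 < t ^ γ := Real.rpow_pos_of_pos ht0 _
    rw [deficit_eq hp hΩ hb.measure_lt_top.ne ht0]
    simp only [Function.comp, ENNReal.toReal_div, ENNReal.toReal_ofReal hs.le]
    ring

end FiniteMoment

/-! ### Part (ii): the borderline power decay. -/

section LogarithmicCase

variable {d : ℕ} {κ n m : ℝ}

lemma continuousOn_profile (d : ℕ) {n m : ℝ} (hn : 0 < n) :
    ContinuousOn (fun r : ℝ => r ^ d / (1 + r ^ n) ^ m) (Ici 0) := by
  have h1 : ContinuousOn (fun r : ℝ => 1 + r ^ n) (Ici 0) := by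
    have := Real.continuous_rpow_const hn.le
    fun_prop
  have h2 : ∀ r ∈ Ici (0 : ℝ), 0 < 1 + r ^ n := fun r hr => by
    have := Real.rpow_nonneg (mem_Ici.1 hr) n
    linarith
  exact (continuous_pow d).continuousOn.div (h1.rpow_const fun r hr => Or.inl (h2 r hr).ne')
    fun r hr => (Real.rpow_pos_of_pos (h2 r hr) m).ne'

lemma inv_rpow_profile_le (hm : 0 < m) (hnm : (d : ℝ) - n * m = -1) {r : ℝ}
    (hr : 0 < r) : 1 / (1 + r ^ n) ^ m ≤ (r ^ (d + 1))⁻¹ := by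
  rw [one_div]
  refine inv_anti₀ (by positivity) ?_
  have h : r ^ (d + 1) = (r ^ n) ^ m := by
    rw [← Real.rpow_mul hr.le, ← Real.rpow_natCast]
    congr 1
    push_cast
    linarith
  rw [h]
  exact Real.rpow_le_rpow (by positivity) (by linarith) hm.le

/-- Since `nm = d + 1`, the integrand beyond 1 is at most `1/r`; this is the source of the
logarithm. -/
lemma integral_profile_le (hn : 0 < n) (hm : 0 < m) (hnm : (d : ℝ) - n * m = -1) {R : ℝ}
    (hR : 1 ≤ R) :
    ∫ r in (0 : ℝ)..R, r ^ d / (1 + r ^ n) ^ m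
      ≤ (∫ r in (0 : ℝ)..1, r ^ d / (1 + r ^ n) ^ m) + Real.log R := by
  have hi : ∀ a b : ℝ, 0 ≤ a → 0 ≤ b → IntervalIntegrable
      (fun r : ℝ => r ^ d / (1 + r ^ n) ^ m) volume a b := fun a b ha hb =>
    ((continuousOn_profile d hn).mono fun x hx => le_trans (le_min ha hb) hx.1).intervalIntegrable
  have h0 : (0 : ℝ) ∉ uIcc 1 R := fun h => by
    rw [uIcc_of_le hR] at h
    linarith [h.1]
  rw [← intervalIntegral.integral_add_adjacent_intervals (hi 0 1 le_rfl zero_le_one)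
    (hi 1 R zero_le_one (by linarith))]
  gcongr
  calc ∫ r in (1 : ℝ)..R, r ^ d / (1 + r ^ n) ^ m
      ≤ ∫ r in (1 : ℝ)..R, r⁻¹ := by
        refine intervalIntegral.integral_mono_on hR (hi 1 R zero_le_one (by linarith))
          (intervalIntegrable_inv_iff.2 (Or.inr h0)) fun r hr => ?_
        have hr0 : 0 < r := by linarith [hr.1]
        have := mul_le_mul_of_nonneg_left (inv_rpow_profile_le hm hnm hr0) (pow_nonneg hr0.le d)
        rw [← mul_one_div]
        refine this.trans_eq ?_
        rw [pow_succ]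
        field_simp
    _ = Real.log R := by rw [integral_inv h0, div_one]

variable {q : E d → ℝ≥0∞}

lemma lintegral_profile_near_le (hd : 1 ≤ d) (hκ : 0 < κ) (hn : 0 < n) (hm : 0 < m)
    (hnm : (d : ℝ) - n * m = -1)
    (hq : ∀ x : E d, q x = ENNReal.ofReal (κ / (1 + ‖x‖ ^ n) ^ m)) {R : ℝ} (hR : 1 ≤ R) :
    ∫⁻ r in Ioi (0 : ℝ), ENNReal.ofReal (r ^ d)
        * (Metric.ball (0 : E d) R).indicator q (r • lastVec d)
      ≤ ENNReal.ofReal (κ * ((∫ r in (0 : ℝ)..1, r ^ d / (1 + r ^ n) ^ m) + Real.log R)) := by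
  set a : ℝ → ℝ := fun r => r ^ d / (1 + r ^ n) ^ m with ha
  have ha0 : ∀ r, 0 ≤ r → 0 ≤ a r := fun r hr => by simp only [ha]; positivity
  have hR0 : (0 : ℝ) ≤ R := by linarith
  calc ∫⁻ r in Ioi (0 : ℝ), ENNReal.ofReal (r ^ d)
        * (Metric.ball (0 : E d) R).indicator q (r • lastVec d)
      ≤ ∫⁻ r in Ioi (0 : ℝ), (Ioc 0 R).indicator (fun r => ENNReal.ofReal (κ * a r)) r := by
        refine setLIntegral_mono' measurableSet_Ioi fun r hr => ?_
        have hr0 : (0 : ℝ) < r := hr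
        have hnr : ‖r • lastVec d‖ = r := by
          rw [norm_smul, norm_lastVec hd, mul_one, Real.norm_of_nonneg hr0.le]
        by_cases h : r • lastVec d ∈ Metric.ball (0 : E d) R
        · have hrR : r < R := by rwa [mem_ball_zero_iff, hnr] at h
          rw [indicator_of_mem h, indicator_of_mem (mem_Ioc.2 ⟨hr0, hrR.le⟩), hq, hnr,
            ← ENNReal.ofReal_mul (by positivity)]
          refine ENNReal.ofReal_le_ofReal (le_of_eq ?_)
          simp only [ha]
          ring
        · simp [indicator_of_notMem h]
    _ ≤ ∫⁻ r, (Ioc 0 R).indicator (fun r => ENNReal.ofReal (κ * a r)) r :=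
        setLIntegral_le_lintegral _ _
    _ = ∫⁻ r in Ioc 0 R, ENNReal.ofReal (κ * a r) := lintegral_indicator measurableSet_Ioc _
    _ = ENNReal.ofReal (∫ r in Ioc 0 R, κ * a r) := by
        rw [ofReal_integral_eq_lintegral_ofReal]
        · exact (((continuousOn_profile d hn).mono Icc_subset_Ici_self).integrableOn_Icc.mono_set
            Ioc_subset_Icc_self).const_mul κ
        · exact (ae_restrict_mem measurableSet_Ioc).mono fun r hr =>
            mul_nonneg hκ.le (ha0 r hr.1.le)
    _ ≤ _ := by
        rw [integral_const_mul, ← intervalIntegral.integral_of_le hR0]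
        refine ENNReal.ofReal_le_ofReal (mul_le_mul_of_nonneg_left ?_ hκ.le)
        exact integral_profile_le hn hm hnm hR

lemma radial_indicator_ball {q : E d → ℝ≥0∞} (hr : ∀ x y : E d, ‖x‖ = ‖y‖ → q x = q y) (R : ℝ)
    (x y : E d) (h : ‖x‖ = ‖y‖) :
    (Metric.ball (0 : E d) R).indicator q x = (Metric.ball (0 : E d) R).indicator q y ∧
      (Metric.ball (0 : E d) R)ᶜ.indicator q x = (Metric.ball (0 : E d) R)ᶜ.indicator q y := by
  by_cases hx : ‖y‖ < R <;> simp [indicator, h, hx, hr x y h]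

/-- In polar coordinates the tail density is at most `κ r^{d-1} r^{-(d+1)} = κ r^{-2}`. -/
lemma lintegral_profile_far_le (hd : 1 ≤ d) (hκ : 0 < κ) (hm : 0 < m)
    (hnm : (d : ℝ) - n * m = -1)
    (hq : ∀ x : E d, q x = ENNReal.ofReal (κ / (1 + ‖x‖ ^ n) ^ m)) {R : ℝ} (hR : 0 < R) :
    ∫⁻ x, (Metric.ball (0 : E d) R)ᶜ.indicator q x
      ≤ ENNReal.ofReal (sphereArea d * (κ * R⁻¹)) := by
  have hA : 0 ≤ sphereArea d := mul_nonneg (Nat.cast_nonneg d) (ballVol_pos d).le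
  have hqr : ∀ x y : E d, ‖x‖ = ‖y‖ → q x = q y := fun x y h => by rw [hq, hq, h]
  have hqm : Measurable q := by
    have : q = fun x => ENNReal.ofReal (κ / (1 + ‖x‖ ^ n) ^ m) := funext hq
    rw [this]
    fun_prop
  rw [lintegral_radial hd (hqm.indicator measurableSet_ball.compl).aemeasurable
    fun x y h => (radial_indicator_ball hqr R x y h).2, ENNReal.ofReal_mul hA]
  gcongr
  calc ∫⁻ r in Ioi (0 : ℝ), ENNReal.ofReal (r ^ (d - 1))
        * (Metric.ball (0 : E d) R)ᶜ.indicator q (r • lastVec d)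
      ≤ ∫⁻ r in Ioi (0 : ℝ), (Ici R).indicator (fun r => ENNReal.ofReal (κ * r ^ (-2 : ℝ))) r := by
        refine setLIntegral_mono' measurableSet_Ioi fun r hr => ?_
        have hr0 : (0 : ℝ) < r := hr
        have hnr : ‖r • lastVec d‖ = r := by
          rw [norm_smul, norm_lastVec hd, mul_one, Real.norm_of_nonneg hr0.le]
        by_cases h : r • lastVec d ∈ (Metric.ball (0 : E d) R)ᶜ
        · have hrR : R ≤ r := by simpa [hnr] using h
          rw [indicator_of_mem h, indicator_of_mem (mem_Ici.2 hrR), hq, hnr,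
            ← ENNReal.ofReal_mul (by positivity)]
          refine ENNReal.ofReal_le_ofReal ?_
          have h1 := mul_le_mul_of_nonneg_left (inv_rpow_profile_le hm hnm hr0)
            (mul_nonneg hκ.le (pow_nonneg hr0.le (d - 1)))
          have h2 : r ^ (d + 1) = r ^ (d - 1) * r ^ 2 := by
            rw [← pow_add]
            congr 1
            omega
          calc r ^ (d - 1) * (κ / (1 + r ^ n) ^ m)
              = κ * r ^ (d - 1) * (1 / (1 + r ^ n) ^ m) := by ring
            _ ≤ κ * r ^ (d - 1) * (r ^ (d + 1))⁻¹ := h1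
            _ = κ * r ^ (-2 : ℝ) := by
                rw [h2, Real.rpow_neg hr0.le, Real.rpow_two]
                field_simp
        · simp [indicator_of_notMem h]
    _ ≤ ∫⁻ r, (Ici R).indicator (fun r => ENNReal.ofReal (κ * r ^ (-2 : ℝ))) r :=
        setLIntegral_le_lintegral _ _
    _ = ∫⁻ r in Ioi R, ENNReal.ofReal (κ * r ^ (-2 : ℝ)) := by
        rw [lintegral_indicator measurableSet_Ici, setLIntegral_congr Ioi_ae_eq_Ici]
    _ = ENNReal.ofReal (∫ r in Ioi R, κ * r ^ (-2 : ℝ)) := by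
        rw [ofReal_integral_eq_lintegral_ofReal]
        · exact (integrableOn_Ioi_rpow_of_lt (by norm_num) hR).const_mul κ
        · refine (ae_restrict_mem measurableSet_Ioi).mono fun r hr => ?_
          have : 0 < r := hR.trans hr
          simp only [Pi.zero_apply]
          positivity
    _ = ENNReal.ofReal (κ * R⁻¹) := by
        rw [integral_const_mul, integral_Ioi_rpow_of_lt (by norm_num) hR]
        norm_num [Real.rpow_neg_one]

lemma averagedVariation_split {q : E d → ℝ≥0∞} (Ω B : Set (E d)) (hB : MeasurableSet B)
    (hq : AEMeasurable q volume) (hΩ : MeasurableSet Ω) (s : ℝ) :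
    averagedVariation q Ω s
      = averagedVariation (B.indicator q) Ω s + averagedVariation (Bᶜ.indicator q) Ω s := by
  have hsv : Measurable fun z : E d =>
      shiftVariation (Ω.indicator fun _ => (1 : ℝ)) (s • z) :=
    (measurable_shiftVariation (measurable_const.indicator hΩ)).comp (measurable_const_smul s)
  rw [averagedVariation, averagedVariation, averagedVariation,
    ← lintegral_add_left' (f := fun z => B.indicator q z *
      shiftVariation (Ω.indicator fun _ => (1 : ℝ)) (s • z))
      ((hq.indicator hB).mul hsv.aemeasurable)]
  refine lintegral_congr fun z => ?_
  rw [← add_mul, indicator_self_add_compl_apply]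

variable {β γ : ℝ} {p : ℝ → E d → ℝ≥0∞}

/-- The logarithmic upper bound, with an arbitrary cut-off length `ℓ`. -/
lemma deficit_le_log (hd : 1 ≤ d) (hp : IsHeatKernel β γ p) {Ω : Set (E d)}
    (hΩ : MeasurableSet Ω) (hb : Bornology.IsBounded Ω) (hP : perimeter Ω < ∞)
    (hκ : 0 < κ) (hn : 0 < n) (hm : 0 < m) (hnm : (d : ℝ) - n * m = -1)
    (hq : ∀ x : E d, p 1 x = ENNReal.ofReal (κ / (1 + ‖x‖ ^ n) ^ m))
    {ℓ t : ℝ} (ht : 0 < t) (hℓ : t ^ γ < ℓ) :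
    deficit β γ p Ω t ≤ t ^ γ * (((volume Ω).toReal * ℓ⁻¹ * sphereArea d * κ
      + κ * ballVol (d - 1) * (perimeter Ω).toReal
        * (Real.log ℓ + ∫ r in (0 : ℝ)..1, r ^ d / (1 + r ^ n) ^ m))
      + κ * ballVol (d - 1) * (perimeter Ω).toReal * γ * Real.log (1 / t)) := by
  have hs : 0 < t ^ γ := Real.rpow_pos_of_pos ht _
  have hv := hb.measure_lt_top (μ := volume).ne
  have hℓ0 : 0 < ℓ := hs.trans hℓ
  have hw := ballVol_pos (d - 1)
  have hA : 0 ≤ sphereArea d := mul_nonneg (Nat.cast_nonneg d) (ballVol_pos d).le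
  set s := t ^ γ with hsdef
  -- A displacement of length `ℓ` has length `R` in the rescaled variable. Then `log R` splits into
  -- `log ℓ + γ log(1/t)`, and the tail factor `R⁻¹ = s/ℓ` supplies the power `t^γ`.
  set R : ℝ := ℓ / s with hR
  have hR1 : 1 < R := (one_lt_div hs).2 hℓ
  set a : ℝ := ∫ r in (0 : ℝ)..1, r ^ d / (1 + r ^ n) ^ m with ha
  have ha0 : 0 ≤ a := intervalIntegral.integral_nonneg zero_le_one fun r hr => by
    have := hr.1
    positivity
  have hlogR : 0 ≤ Real.log R := Real.log_nonneg hR1.le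
  have hqm := hp.aemeasurable 1 one_pos
  have hqr := hp.radial 1 one_pos
  have hnear := lintegral_mul_shiftVariation_le hd (hqm.indicator measurableSet_ball)
    (fun x y h => (radial_indicator_ball hqr R x y h).1) hΩ hb hP hs
  have hnear2 : dirMoment ((Metric.ball (0 : E d) R).indicator (p 1))
      ≤ ENNReal.ofReal (2 * ballVol (d - 1)) * ENNReal.ofReal (κ * (a + Real.log R)) :=
    mul_le_mul_right (lintegral_profile_near_le hd hκ hn hm hnm hq hR1.le) _
  have hfar := (averagedVariation_le ((Metric.ball (0 : E d) R)ᶜ.indicator (p 1)) hΩ hv s).trans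
    (mul_le_mul_right (lintegral_profile_far_le hd hκ hm hnm hq (by linarith : (0 : ℝ) < R)) _)
  have htot : averagedVariation (p 1) Ω s
      ≤ ENNReal.ofReal s * ((ENNReal.ofReal (2 * ballVol (d - 1)) *
          ENNReal.ofReal (κ * (a + Real.log R))) * perimeter Ω)
        + 2 * volume Ω * ENNReal.ofReal (sphereArea d * (κ * R⁻¹)) := by
    rw [averagedVariation_split Ω _ measurableSet_ball hqm hΩ]
    refine add_le_add (hnear.trans ?_) hfar
    gcongr
  have f1 : ENNReal.ofReal s * ((ENNReal.ofReal (2 * ballVol (d - 1)) *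
      ENNReal.ofReal (κ * (a + Real.log R))) * perimeter Ω) ≠ ∞ :=
    ENNReal.mul_ne_top ENNReal.ofReal_ne_top (ENNReal.mul_ne_top
      (ENNReal.mul_ne_top ENNReal.ofReal_ne_top ENNReal.ofReal_ne_top) hP.ne)
  have f2 : 2 * volume Ω * ENNReal.ofReal (sphereArea d * (κ * R⁻¹)) ≠ ∞ :=
    ENNReal.mul_ne_top (ENNReal.mul_ne_top (by norm_num) hv) ENNReal.ofReal_ne_top
  have h := ENNReal.toReal_mono (ENNReal.add_ne_top.2 ⟨f1, f2⟩) htot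
  rw [ENNReal.toReal_add f1 f2] at h
  simp only [ENNReal.toReal_mul, ENNReal.toReal_ofNat] at h
  rw [ENNReal.toReal_ofReal hs.le, ENNReal.toReal_ofReal (by positivity),
    ENNReal.toReal_ofReal (by positivity), ENNReal.toReal_ofReal (by positivity)] at h
  rw [deficit_eq hp hΩ hv ht]
  have hlog : Real.log R = Real.log ℓ + γ * Real.log (1 / t) := by
    rw [hR, Real.log_div hℓ0.ne' hs.ne', hsdef, Real.log_rpow ht, one_div, Real.log_inv]
    ring
  have hRinv : R⁻¹ = s * ℓ⁻¹ := by rw [hR, inv_div, div_eq_mul_inv]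
  rw [hlog, hRinv] at h
  linarith

lemma limsup_deficit_le (hd : 1 ≤ d) (hp : IsHeatKernel β γ p) {Ω : Set (E d)}
    (hΩ : MeasurableSet Ω) (hb : Bornology.IsBounded Ω) (hP : perimeter Ω < ∞)
    (hκ : 0 < κ) (hn : 0 < n) (hm : 0 < m) (hnm : (d : ℝ) - n * m = -1)
    (hq : ∀ x : E d, p 1 x = ENNReal.ofReal (κ / (1 + ‖x‖ ^ n) ^ m)) :
    limsup (fun t : ℝ => ((deficit β γ p Ω t / (t ^ γ * Real.log (1 / t)) : ℝ) : EReal)) (𝓝[>] 0)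
      ≤ ((κ * (perimeter Ω).toReal * ballVol (d - 1) * γ : ℝ) : EReal) := by
  set c : ℝ := κ * ballVol (d - 1) * (perimeter Ω).toReal * γ with hc
  -- The cut-off length is 1: any fixed length gives the same leading term, and this one avoids the
  -- case of zero diameter.
  set C : ℝ := (volume Ω).toReal * (1 : ℝ)⁻¹ * sphereArea d * κ
      + κ * ballVol (d - 1) * (perimeter Ω).toReal
        * (Real.log 1 + ∫ r in (0 : ℝ)..1, r ^ d / (1 + r ^ n) ^ m) with hC
  have hlog : Tendsto (fun t : ℝ => Real.log (1 / t)) (𝓝[>] 0) atTop := by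
    simp only [one_div]
    exact Real.tendsto_log_atTop.comp tendsto_inv_nhdsGT_zero
  have hlim : Tendsto (fun t : ℝ => C / Real.log (1 / t) + c) (𝓝[>] 0) (𝓝 c) := by
    simpa using (hlog.const_div_atTop C).add_const c
  have hlim2 := (continuous_coe_real_ereal.tendsto c).comp hlim
  have hcc : κ * (perimeter Ω).toReal * ballVol (d - 1) * γ = c := by rw [hc]; ring
  rw [hcc, ← hlim2.limsup_eq]
  refine limsup_le_limsup ?_
  filter_upwards [self_mem_nhdsWithin, nhdsWithin_le_nhds (Iio_mem_nhds (zero_lt_one (α := ℝ)))]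
    with t ht0 ht1
  have ht : (0 : ℝ) < t := ht0
  have hs : 0 < t ^ γ := Real.rpow_pos_of_pos ht _
  have hL : 0 < Real.log (1 / t) := Real.log_pos ((one_lt_div ht).2 ht1)
  have h := deficit_le_log hd hp hΩ hb hP hκ hn hm hnm hq ht
    (Real.rpow_lt_one ht.le ht1 hp.gamma_pos)
  simp only [Function.comp, EReal.coe_le_coe_iff]
  rw [div_le_iff₀ (by positivity)]
  refine h.trans_eq ?_
  rw [← hC, ← hc]
  field_simp

end LogarithmicCase

/-! ### Part (iii): dominated convergence off the diagonal. -/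

section SingularLimit

variable {d : ℕ} {β γ : ℝ} {p : ℝ → E d → ℝ≥0∞}

lemma exchange_eq_lintegral_prod {q : E d → ℝ≥0∞} {Ω : Set (E d)}
    (hq : AEMeasurable (fun z : E d × E d => q (z.1 - z.2))
      ((volume.restrict Ω).prod (volume.restrict Ωᶜ))) :
    exchange q Ω
      = ∫⁻ z, q (z.1 - z.2) ∂((volume.restrict Ω).prod (volume.restrict Ωᶜ)) :=
  (lintegral_prod _ hq).symm

lemma tendsto_exchange_div (hp : IsHeatKernel β γ p) {Ω : Set (E d)} (hΩ : MeasurableSet Ω)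
    {φ : ℝ → ℝ≥0} {J Λ : E d → ℝ≥0∞} (hφ : ∀ t ∈ Ioc (0 : ℝ) 1, 0 < φ t)
    (hΛm : AEMeasurable Λ volume)
    (hle : ∀ x : E d, x ≠ 0 → ∀ t ∈ Ioc (0 : ℝ) 1, p t x / (φ t : ℝ≥0∞) ≤ Λ x)
    (hlim : ∀ x : E d, x ≠ 0 →
      Tendsto (fun t : ℝ => p t x / (φ t : ℝ≥0∞)) (𝓝[>] 0) (𝓝 (J x)))
    (hΛ : exchange Λ Ω < ∞) :
    Tendsto (fun t : ℝ => exchange (p t) Ω / (φ t : ℝ≥0∞)) (𝓝[>] 0) (𝓝 (exchange J Ω)) := by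
  set μ := (volume.restrict Ω).prod (volume.restrict Ωᶜ) with hμ
  have hIoc : ∀ᶠ t : ℝ in 𝓝[>] 0, t ∈ Ioc (0 : ℝ) 1 := Ioc_mem_nhdsGT one_pos
  -- A point of `Ω` differs from a point of `Ωᶜ`, so hypotheses away from the origin suffice.
  have hne : ∀ᵐ z ∂μ, z.1 - z.2 ≠ 0 := by
    rw [hμ, Measure.prod_restrict]
    filter_upwards [ae_restrict_mem (hΩ.prod hΩ.compl)] with z hz h
    exact hz.2 (sub_eq_zero.1 h ▸ hz.1)
  have hm : ∀ t ∈ Ioc (0 : ℝ) 1,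
      AEMeasurable (fun z : E d × E d => p t (z.1 - z.2) / (φ t : ℝ≥0∞)) μ := fun t ht =>
    (aemeasurable_comp_sub (hp.aemeasurable t ht.1) _ _).div_const _
  -- Measurability of `J` is inherited from the kernels along `t = 1/(n+1)`.
  have hJm : AEMeasurable (fun z : E d × E d => J (z.1 - z.2)) μ := by
    have hu : Tendsto (fun n : ℕ => 1 / ((n : ℝ) + 1)) atTop (𝓝[>] 0) :=
      tendsto_nhdsWithin_iff.2 ⟨tendsto_one_div_add_atTop_nhds_zero_nat,
        Eventually.of_forall fun n => by simp only [mem_Ioi]; positivity⟩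
    refine aemeasurable_of_tendsto_metrizable_ae'
      (fun n : ℕ => hm (1 / ((n : ℝ) + 1)) ⟨by positivity, ?_⟩) ?_
    · rw [div_le_one (by positivity)]
      linarith [(Nat.cast_nonneg n : (0 : ℝ) ≤ n)]
    · filter_upwards [hne] with z hz
      exact (hlim _ hz).comp hu
  have hΛp := exchange_eq_lintegral_prod (aemeasurable_comp_sub hΛm Ω Ωᶜ)
  rw [exchange_eq_lintegral_prod hJm]
  refine (tendsto_lintegral_filter_of_dominated_convergence'
    (F := fun (t : ℝ) (z : E d × E d) => p t (z.1 - z.2) / (φ t : ℝ≥0∞))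
    (fun z => Λ (z.1 - z.2)) (hIoc.mono hm) ?_ (hΛp ▸ hΛ.ne) ?_).congr' ?_
  · filter_upwards [hIoc] with t ht
    filter_upwards [hne] with z hz
    exact hle _ hz t ht
  · filter_upwards [hne] with z hz
    exact hlim _ hz
  · filter_upwards [hIoc] with t ht
    rw [exchange_eq_lintegral_prod (aemeasurable_comp_sub (hp.aemeasurable t ht.1) _ _)]
    simp_rw [div_eq_mul_inv]
    rw [lintegral_mul_const' _ _ (ENNReal.inv_ne_top.2 (ENNReal.coe_ne_zero.2 (hφ t ht).ne'))]

end SingularLimit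

end HeatContent

end

/-! ### Reduction to Borel sets and assembly. -/

theorem theorem1p1 (d : ℕ) (hd : 2 ≤ d)
    (Ω : Set (HeatContent.E d)) (hΩ : NullMeasurableSet Ω volume)
    (hΩb : Bornology.IsBounded Ω) (hPer : HeatContent.perimeter Ω < ∞)
    (β γ : ℝ) (p : ℝ → HeatContent.E d → ℝ≥0∞) (hp : HeatContent.IsHeatKernel β γ p) :
    -- (i)
    ((∫⁻ x : HeatContent.E d, ENNReal.ofReal ‖x‖ * p 1 x) < ∞ →
      (∀ t : ℝ, 0 < t →
        HeatContent.deficit β γ p Ω t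
          ≤ t ^ γ * HeatContent.ballVol (d - 1) * (HeatContent.perimeter Ω).toReal
              * (HeatContent.radialMoment p).toReal) ∧
      Tendsto (fun t : ℝ => HeatContent.deficit β γ p Ω t / t ^ γ) (𝓝[>] 0)
        (𝓝 (HeatContent.ballVol (d - 1) * (HeatContent.perimeter Ω).toReal
              * (HeatContent.radialMoment p).toReal))) ∧
    -- (ii)
    (∀ κ n m : ℝ, 0 < κ → 0 < n → 0 < m → (d : ℝ) - n * m = -1 →
      (∀ t : ℝ, 0 < t → ∀ x : HeatContent.E d,
        p t x = ENNReal.ofReal (κ * t ^ β / (1 + ‖t ^ (-γ) • x‖ ^ n) ^ m)) →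
      (∀ t : ℝ, 0 < t → t ^ γ < Metric.diam Ω →
        HeatContent.deficit β γ p Ω t
          ≤ t ^ γ * (HeatContent.lambdaConst κ n m Ω
              + κ * HeatContent.ballVol (d - 1) * (HeatContent.perimeter Ω).toReal * γ
                  * Real.log (1 / t))) ∧
      limsup (fun t : ℝ =>
          ((HeatContent.deficit β γ p Ω t / (t ^ γ * Real.log (1 / t)) : ℝ) : EReal)) (𝓝[>] 0)
        ≤ ((κ * (HeatContent.perimeter Ω).toReal * HeatContent.ballVol (d - 1) * γ : ℝ)
            : EReal)) ∧
    -- (iii)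
    (∀ (φ : ℝ → ℝ≥0) (J Λ : HeatContent.E d → ℝ≥0∞),
      (∀ t ∈ Ioc (0 : ℝ) 1, 0 < φ t) → (∀ x, 0 < J x) → (∀ x, 0 < Λ x) →
      AEMeasurable Λ volume →
      (∀ x : HeatContent.E d, x ≠ 0 → ∀ t ∈ Ioc (0 : ℝ) 1, p t x / (φ t : ℝ≥0∞) ≤ Λ x) →
      (∀ x : HeatContent.E d, x ≠ 0 →
        Tendsto (fun t : ℝ => p t x / (φ t : ℝ≥0∞)) (𝓝[>] 0) (𝓝 (J x))) →
      (∫⁻ x in Ω, ∫⁻ y in Ωᶜ, J (x - y)) < ∞ →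
      (∫⁻ x in Ω, ∫⁻ y in Ωᶜ, Λ (x - y)) < ∞ →
      Tendsto (fun t : ℝ =>
          (t ^ ((d : ℝ) * γ + β) * HeatContent.kernelNorm p * (volume Ω).toReal
            - (HeatContent.heatContent p Ω t).toReal) / (φ t : ℝ)) (𝓝[>] 0)
        (𝓝 (∫⁻ x in Ω, ∫⁻ y in Ωᶜ, J (x - y)).toReal)) := by
  have hd1 : 1 ≤ d := by omega
  -- Volume, perimeter, heat content and exchange ignore null sets; taking a subset preserves
  -- boundedness.
  obtain ⟨Ω', hsub, hm, hae⟩ := hΩ.exists_measurable_subset_ae_eq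
  have hb' : Bornology.IsBounded Ω' := hΩb.subset hsub
  have hv : volume Ω' = volume Ω := measure_congr hae
  have hr : volume.restrict Ω' = volume.restrict Ω := Measure.restrict_congr_set hae
  have hrc : volume.restrict Ω'ᶜ = volume.restrict Ωᶜ := Measure.restrict_congr_set hae.compl
  have hper : HeatContent.perimeter Ω' = HeatContent.perimeter Ω := by
    simp only [HeatContent.perimeter, hr]
  have hheat : ∀ t, HeatContent.heatContent p Ω' t = HeatContent.heatContent p Ω t := fun t => by
    simp only [HeatContent.heatContent, hr]
  have hdef : ∀ t, HeatContent.deficit β γ p Ω' t = HeatContent.deficit β γ p Ω t := fun t => by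
    simp only [HeatContent.deficit, hheat, hv]
  have hex : ∀ q : HeatContent.E d → ℝ≥0∞,
      HeatContent.exchange q Ω' = ∫⁻ x in Ω, ∫⁻ y in Ωᶜ, q (x - y) := fun q => by
    simp only [HeatContent.exchange, hr, hrc]
  have hPer' : HeatContent.perimeter Ω' < ∞ := hper ▸ hPer
  refine ⟨fun hmom => ⟨fun t ht => ?_, ?_⟩, fun κ n m hκ hn hm0 hnm hform => ?_,
    fun φ J Λ hφ _ _ hΛm hle hlim hJfin hΛfin => ?_⟩
  · rw [← hdef, ← hper]
    exact HeatContent.deficit_le_of_moment hd1 hp hm hb' hPer' hmom ht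
  · simp_rw [← hdef, ← hper]
    exact HeatContent.tendsto_deficit_of_moment hd1 hp hm hb' hPer' hmom
  · have hq : ∀ x : HeatContent.E d, p 1 x = ENNReal.ofReal (κ / (1 + ‖x‖ ^ n) ^ m) := fun x => by
      simpa using hform 1 one_pos x
    refine ⟨fun t ht hℓ => ?_, ?_⟩
    · rw [HeatContent.lambdaConst, ← hdef, ← hper, ← hv]
      -- The diameter may change under a null modification, but the cut-off length is arbitrary, so
      -- the diameter of the original `Ω` is used.
      exact HeatContent.deficit_le_log hd1 hp hm hb' hPer' hκ hn hm0 hnm hq ht hℓ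
    · simp_rw [← hdef, ← hper]
      exact HeatContent.limsup_deficit_le hd1 hp hm hb' hPer' hκ hn hm0 hnm hq
  · rw [← hex] at hJfin hΛfin ⊢
    have h := (ENNReal.tendsto_toReal hJfin.ne).comp
      (HeatContent.tendsto_exchange_div hp hm hφ hΛm hle hlim hΛfin)
    refine h.congr' ?_
    filter_upwards [self_mem_nhdsWithin] with t ht
    rw [← hheat, ← hv, HeatContent.kernelNorm_mul_sub_heatContent hp hm
      hb'.measure_lt_top.ne ht]
    simp [ENNReal.toReal_div]
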